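/- Let $\mathbb{K}\in\{\mathbb{R},\mathbb{C}\}$, let $A$ be a (not necessarily unital) Banach algebra over $\mathbb{K}$, let $G$ be a locally compact Hausdorff group with a fixed left Haar measure $dr$ and modular function $\Delta$ (normalized by $\int_G f(r)\,dr=\int_G f(r^{-1})\Delta(r^{-1})\,dr$), and let $\alpha:G\to\mathrm{Aut}(A)$ be a strongly continuous representation with $\sup_{s}\|\alpha_s\|<\infty$. Assume that $A$ has a bounded two-sided approximate identity. Let $\omega$ be a weight on $G$, i.e. a non-zero, submultiplicative, Borel measurable function $\omega:G\to[0,\infty)$, and let $L^1(G,A,\omega;\alpha)$ be the completion of $C_c(G,A)$ for the norm $\|f\|_{1,\omega}=\int_G\|f(r)\|\omega(r)\,dr$, with the continuous multiplication extending $[f*g](s)=\int_G f(r)\alpha_r(g(r^{-1}s))\,dr$. Let $X$ be a Banach space over $\mathbb{K}$. A bounded linear map into $B(X)$ is called non-degenerate if the span of the ranges of its values is dense in $X$. Consider, on the one hand, the pairs $(\pi,U)$ such that $\pi:A\to B(X)$ is a non-degenerate bounded anti-representation, $U:G\to B(X)$ is a strongly continuous anti-representation, $U_r\pi(a)U_r^{-1}=\pi(\alpha_{r^{-1}}(a))$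 for all $a\in A$, $r\in G$, and $\|U_r\|\le C_U\,\omega(r)$ for some constant $C_U$ and all $r\in G$; and, on the other hand, the non-degenerate bounded anti-representations $T$ of $L^1(G,A,\omega;\alpha)$ on $X$. Then the following two maps are well defined and mutually inverse bijections between these two classes. (i) $(\pi,U)\mapsto T^{(\pi,U)}$, where $T^{(\pi,U)}$ is determined by $T^{(\pi,U)}(f)x=\int_G U_r\pi(f(r))x\,dr$ for $f\in C_c(G,A)$, $x\in X$. (ii) $T\mapsto(\pi^T,U^T)$, where $$\pi^T(a)=\text{SOT-}\lim_{(V,i)}T\big((z_V\otimes u_ia)^\vee\big)\quad(a\in A),\qquad U^T_s=\text{SOT-}\lim_{(V,i)}T\big((z_V(\cdot\, s^{-1})\otimes u_i)^\vee\big)\quad(s\in G).$$ Here $f^\vee(r)=\Delta(r^{-1})\alpha_r(f(r))$ for $f\in C_c(G,A)$; $(z\otimes a)(r)=z(r)a$; $\mathcal{Z}$ is any neighbourhood base of $e\in G$ all of whose elements are contained in one fixed compact set, directed by reverse inclusion; for $V\in\mathcal{Z}$, $z_V\in C_c(G)$ is any function with $z_V\ge0$, supported in $V$, with $\int_G z_V(r^{-1})\,dr=1$;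 and $(u_i)$ is any bounded approximate right identity of $A$ (a net with $au_i\to a$ for all $a\in A$). Furthermore: 1. $\|T^{(\pi,U)}\|\le C_U\|\pi\|$ for every constant $C_U$ such that $\|U_r\|\le C_U\,\omega(r)$ for all $r\in G$; 2. $\|\pi^T\|\le\big(\inf_{V\in\mathcal{Z}}\sup_{r\in V}\omega(r)\big)\|T\|$; 3. if $A$ has an approximate right identity bounded by $M$, then $\|U^T_s\|\le M\big(\inf_{V\in\mathcal{Z}}\sup_{r\in V}\omega(r)\big)\|T\|\,\omega(s)$ for all $s\in G$. -/

import Mathlib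

open MeasureTheory Filter Topology CompactlySupported
open scoped Pointwise

set_option linter.unusedSectionVars false

noncomputable section

namespace BeurlingAnti

/-- A Banach algebra dynamical system `(A, G, α)` with `α` uniformly bounded: a strongly continuous
representation of `G` on `A` by bounded algebra homomorphisms (each of which is then an
automorphism, with inverse `α s⁻¹`), such that `‖α s‖ ≤ C` for some `C` and all `s`. -/
structure BddDynSystem (𝕜 G A : Type*) [RCLike 𝕜] [Group G] [TopologicalSpace G]
    [NonUnitalNormedRing A] [NormedSpace 𝕜 A] where
  /-- the representation of `G` on the Banach space `A` -/
  toHom : G →* (A →L[𝕜] A)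
  map_mul' : ∀ s a b, toHom s (a * b) = toHom s a * toHom s b
  strong_cont' : ∀ a, Continuous fun s => toHom s a
  bdd' : ∃ C : ℝ, ∀ s, ‖toHom s‖ ≤ C

instance (𝕜 G A : Type*) [RCLike 𝕜] [Group G] [TopologicalSpace G]
    [NonUnitalNormedRing A] [NormedSpace 𝕜 A] :
    CoeFun (BddDynSystem 𝕜 G A) (fun _ => G → (A →L[𝕜] A)) := ⟨fun α => α.toHom⟩

/-- A weight on `G`: a non-zero, submultiplicative, Borel measurable function `G → [0, ∞)`. -/
structure Weight (G : Type*) [Group G] [MeasurableSpace G] where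
  /-- the underlying function -/
  toFun : G → ℝ
  nonneg' : ∀ s, 0 ≤ toFun s
  submul' : ∀ s t, toFun (s * t) ≤ toFun s * toFun t
  measurable' : Measurable toFun
  ne_zero' : ∃ s, toFun s ≠ 0

instance (G : Type*) [Group G] [MeasurableSpace G] : CoeFun (Weight G) (fun _ => G → ℝ) :=
  ⟨fun ω => ω.toFun⟩

/-- The modular function `Δ` of `G`, normalized by `Δ(s) ∫ f(rs) dr = ∫ f(r) dr` for left Haar
measure, equivalently by `∫ f(r) dr = ∫ f(r⁻¹) Δ(r⁻¹) dr`. (Mathlib's `modularCharacterFun` is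
the reciprocal of this function.) -/
def modulus {G : Type*} [Group G] [TopologicalSpace G] [IsTopologicalGroup G]
    [LocallyCompactSpace G] (s : G) : ℝ :=
  (Measure.modularCharacterFun s⁻¹ : ℝ)

section Group

variable {G : Type*} [Group G] [TopologicalSpace G] [IsTopologicalGroup G]
  [LocallyCompactSpace G] [MeasurableSpace G] [BorelSpace G]

theorem modulus_mul_integral (μ : Measure G) [μ.IsHaarMeasure] (f : G → ℝ) (hf : Continuous f)
    (hc : HasCompactSupport f) (s : G) : modulus s * ∫ r, f (r * s) ∂μ = ∫ r, f r ∂μ := by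
  have key : ∀ (g : G → ℝ), Continuous g → HasCompactSupport g → ∀ t : G,
      ∫ r, g (r * t) ∂μ = (Measure.modularCharacterFun t : ℝ) * ∫ r, g r ∂μ := by
    intro g hg hgc t
    rw [Measure.modularCharacterFun_eq_haarScalarFactor μ t]
    have h := Measure.integral_isMulLeftInvariant_eq_smul_of_hasCompactSupport
      (Measure.map (· * t) μ) μ hg hgc
    rw [integral_map (measurable_mul_const t).aemeasurable hg.aestronglyMeasurable] at h
    rw [h, integral_smul_nnreal_measure]
    rfl
  have h := key (fun r => f (r * s)) (hf.comp (continuous_mul_const s))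
    (hc.comp_homeomorph (Homeomorph.mulRight s)) s⁻¹
  simp only [inv_mul_cancel_right] at h
  exact h.symm

theorem continuous_modulus : Continuous (modulus : G → ℝ) := by
  obtain ⟨⟨f, f_cont⟩, f_comp, f_nonneg, f_one⟩ :
    ∃ f : C(G, ℝ), HasCompactSupport f ∧ 0 ≤ f ∧ f 1 ≠ 0 := exists_continuous_nonneg_pos 1
  let μ : Measure G := Measure.haar
  have hpos : 0 < ∫ r, f r ∂μ :=
    f_cont.integral_pos_of_hasCompactSupport_nonneg_nonzero f_comp f_nonneg f_one
  have hc : Continuous fun s : G => ∫ r, f (r * s) ∂μ := by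
    rw [continuous_iff_continuousAt]
    intro s
    obtain ⟨N, hN, hsN⟩ := exists_compact_mem_nhds s
    have hk : IsCompact (tsupport f * N⁻¹) := f_comp.isCompact.mul hN.inv
    have : ContinuousOn (fun s : G => ∫ r, f (r * s) ∂μ) N := by
      refine continuousOn_integral_of_compact_support hk ?_ ?_
      · exact (f_cont.comp (continuous_snd.mul continuous_fst)).continuousOn
      · intro p r hp hr
        by_contra h
        exact hr ⟨r * p, subset_tsupport _ h, p⁻¹, by simpa using hp, by simp⟩
    exact this.continuousAt hsN
  have hne : ∀ s : G, ∫ r, f (r * s) ∂μ ≠ 0 := by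
    intro s h
    have := modulus_mul_integral μ f f_cont f_comp s
    rw [h, mul_zero] at this
    exact hpos.ne this
  have : (modulus : G → ℝ) = fun s => (∫ r, f r ∂μ) / ∫ r, f (r * s) ∂μ := by
    funext s
    rw [eq_div_iff (hne s)]
    exact modulus_mul_integral μ f f_cont f_comp s
  rw [this]
  exact continuous_const.div hc hne

/-- A weight is bounded on compact sets. -/
theorem Weight.bddOn_compact (ω : Weight G) {K : Set G} (hK : IsCompact K) :
    ∃ C : ℝ, ∀ s ∈ K, ω s ≤ C := by
  let μ : Measure G := Measure.haar
  obtain ⟨N, hN, h1N⟩ := exists_compact_mem_nhds (1 : G)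
  let E : ℕ → Set G := fun n => {s | ω s ≤ n ∧ ω s⁻¹ ≤ n}
  have hE : ∀ n, MeasurableSet (E n) := fun n =>
    (measurableSet_le ω.measurable' measurable_const).inter
      (measurableSet_le (ω.measurable'.comp measurable_inv) measurable_const)
  have hcov : interior N ⊆ ⋃ n, (E n ∩ interior N) := by
    intro s hs
    obtain ⟨n, hn⟩ := exists_nat_ge (max (ω s) (ω s⁻¹))
    exact Set.mem_iUnion.2 ⟨n, ⟨le_trans (le_max_left _ _) hn, le_trans (le_max_right _ _) hn⟩, hs⟩
  have hposN : μ (interior N) ≠ 0 :=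
    (isOpen_interior.measure_pos μ ⟨1, mem_interior_iff_mem_nhds.2 h1N⟩).ne'
  obtain ⟨n, hn⟩ : ∃ n, μ (E n ∩ interior N) ≠ 0 := by
    by_contra! h
    exact hposN (measure_mono_null hcov (measure_iUnion_null h))
  have hfin : μ (E n ∩ interior N) ≠ ⊤ :=
    ((measure_mono (Set.inter_subset_right.trans interior_subset)).trans_lt
      hN.measure_lt_top).ne
  have hnb := Measure.div_mem_nhds_one_of_haar_pos_ne_top μ (E n ∩ interior N)
    ((hE n).inter isOpen_interior.measurableSet) (pos_iff_ne_zero.2 hn) hfin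
  have hbd : ∀ s ∈ (E n ∩ interior N) / (E n ∩ interior N), ω s ≤ n * n := by
    rintro _ ⟨a, ha, b, hb, rfl⟩
    change ω (a / b) ≤ _
    rw [div_eq_mul_inv]
    exact (ω.submul' _ _).trans
      (mul_le_mul ha.1.1 hb.1.2 (ω.nonneg' _) (Nat.cast_nonneg n))
  refine hK.induction_on (p := fun S => ∃ C : ℝ, ∀ s ∈ S, ω s ≤ C) ⟨0, by simp⟩
    ?_ ?_ ?_
  · rintro S T hST ⟨C, hC⟩
    exact ⟨C, fun s hs => hC s (hST hs)⟩
  · rintro S T ⟨C, hC⟩ ⟨D, hD⟩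
    refine ⟨max C D, ?_⟩
    rintro s (hs | hs)
    · exact (hC s hs).trans (le_max_left _ _)
    · exact (hD s hs).trans (le_max_right _ _)
  · intro x _
    refine ⟨_, mem_nhdsWithin_of_mem_nhds
      ((continuous_const_mul x⁻¹).continuousAt.preimage_mem_nhds (by simpa using hnb)),
      ω x * (n * n), ?_⟩
    intro s hs
    have := ω.submul' x (x⁻¹ * s)
    rw [mul_inv_cancel_left] at this
    exact this.trans (mul_le_mul_of_nonneg_left (hbd _ hs) (ω.nonneg' _))

end Group

section Spaces

variable {𝕜 G A : Type*} [RCLike 𝕜] [Group G] [TopologicalSpace G]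
  [NonUnitalNormedRing A] [NormedSpace 𝕜 A]

theorem BddDynSystem.continuous_uncurry (α : BddDynSystem 𝕜 G A) :
    Continuous fun p : G × A => α p.1 p.2 := by
  obtain ⟨C, hC⟩ := α.bdd'
  rw [continuous_iff_continuousAt]
  rintro ⟨r, a⟩
  have h1 : Tendsto (fun p : G × A => α p.1 (p.2 - a)) (𝓝 (r, a)) (𝓝 0) := by
    refine squeeze_zero_norm (a := fun p : G × A => C * ‖p.2 - a‖)
      (fun p => (α p.1).le_of_opNorm_le (hC p.1) _) ?_
    have : Continuous fun p : G × A => C * ‖p.2 - a‖ := by fun_prop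
    simpa using this.tendsto (r, a)
  have h2 : Tendsto (fun p : G × A => α p.1 a) (𝓝 (r, a)) (𝓝 (α r a)) :=
    ((α.strong_cont' a).comp continuous_fst).tendsto (r, a)
  have := h1.add h2
  simpa [ContinuousAt] using this

theorem conv_support (α : BddDynSystem 𝕜 G A) (f g : G → A) (s r : G) (h : f r * α r (g (r⁻¹ * s)) ≠ 0) :
    r ∈ Function.support f ∧ r⁻¹ * s ∈ Function.support g := by
  constructor
  · intro h0; exact h (by simp [h0])
  · intro h0; exact h (by simp [h0])

theorem conv_continuous_uncurry [IsTopologicalGroup G] (α : BddDynSystem 𝕜 G A) (f g : C_c(G, A)) :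
    Continuous fun p : G × G => f p.2 * α p.2 (g (p.2⁻¹ * p.1)) := by
  refine (f.continuous.comp continuous_snd).mul ?_
  exact α.continuous_uncurry.comp (continuous_snd.prodMk
    (g.continuous.comp (continuous_snd.inv.mul continuous_fst)))

variable [MeasurableSpace G]

/-- The space `C_c(G, A)`, to be endowed with the weighted norm `‖·‖_{1,ω}`. (The system `α` is
recorded in the type because it determines the multiplication.) -/
@[nolint unusedArguments]
def WCc (_μ : Measure G) (_α : BddDynSystem 𝕜 G A) (_ω : Weight G) : Type _ := C_c(G, A)

variable (μ : Measure G) (α : BddDynSystem 𝕜 G A) (ω : Weight G)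

instance : AddCommGroup (WCc μ α ω) := inferInstanceAs (AddCommGroup C_c(G, A))
instance : Module 𝕜 (WCc μ α ω) := inferInstanceAs (Module 𝕜 C_c(G, A))
instance : FunLike (WCc μ α ω) G A := inferInstanceAs (FunLike C_c(G, A) G A)

/-- The function `f ∈ C_c(G, A)` as an element of the weighted space. -/
def toWCc (f : C_c(G, A)) : WCc μ α ω := f

variable {μ α ω} in
theorem WCc.continuous (f : WCc μ α ω) : Continuous f :=
  map_continuous (F := C_c(G, A)) f

variable {μ α ω} in
theorem WCc.hasCompactSupport (f : WCc μ α ω) : HasCompactSupport f :=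
  CompactlySupportedContinuousMap.hasCompactSupport' (α := G) (β := A) f

variable [IsTopologicalGroup G] [BorelSpace G] [μ.IsHaarMeasure]

theorem conv_integrable (f g : C_c(G, A)) (s : G) :
    Integrable (fun r => f r * α r (g (r⁻¹ * s))) μ := by
  refine Continuous.integrable_of_hasCompactSupport ?_ ?_
  · exact (conv_continuous_uncurry α f g).comp (Continuous.prodMk_right s)
  · refine f.hasCompactSupport.mono fun r hr => (conv_support α f g s r hr).1

section

variable [NormedSpace ℝ A]

/-- The twisted convolution `[f * g](s) = ∫ f(r) α_r(g(r⁻¹ s)) dr` on `C_c(G, A)`. -/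
def conv (f g : C_c(G, A)) : C_c(G, A) where
  toFun s := ∫ r, f r * α r (g (r⁻¹ * s)) ∂μ
  continuous_toFun := by
    rw [← continuousOn_univ]
    refine continuousOn_integral_of_compact_support f.hasCompactSupport
      (conv_continuous_uncurry α f g).continuousOn ?_
    intro s r _ hr
    simp [image_eq_zero_of_notMem_tsupport hr]
  hasCompactSupport' := by
    refine HasCompactSupport.intro'
      (f.hasCompactSupport.isCompact.mul g.hasCompactSupport.isCompact)
      ((isClosed_tsupport _).mul_left_of_isCompact f.hasCompactSupport) ?_
    intro s hs
    refine integral_eq_zero_of_ae (Eventually.of_forall fun r => ?_)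
    by_contra h
    obtain ⟨h1, h2⟩ := conv_support α f g s r h
    exact hs ⟨r, subset_tsupport _ h1, r⁻¹ * s, subset_tsupport _ h2, by simp⟩

theorem conv_apply (f g : C_c(G, A)) (s : G) :
    conv μ α f g s = ∫ r, f r * α r (g (r⁻¹ * s)) ∂μ := rfl

end

variable [LocallyCompactSpace G]

theorem integrable_mul_weight (h : G → ℝ) (hc : Continuous h) (hs : HasCompactSupport h) :
    Integrable (fun r => h r * ω r) μ := by
  obtain ⟨C, hC⟩ := ω.bddOn_compact hs.isCompact
  obtain ⟨D, hD⟩ := hs.exists_bound_of_continuous hc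
  rw [← integrableOn_iff_integrable_of_support_subset (s := tsupport h)
    (fun r hr => subset_tsupport _ fun h0 => hr (by simp [h0]))]
  refine Measure.integrableOn_of_bounded (M := D * C) hs.isCompact.measure_ne_top
    (hc.measurable.mul ω.measurable').aestronglyMeasurable ?_
  filter_upwards [ae_restrict_mem (isClosed_tsupport h).measurableSet] with r hr
  rw [norm_mul, Real.norm_of_nonneg (ω.nonneg' r)]
  exact mul_le_mul (hD r) (hC r hr) (ω.nonneg' r) ((norm_nonneg _).trans (hD r))

variable {μ α ω} in
theorem WCc.integrable (f : WCc μ α ω) : Integrable (fun r => ‖f r‖ * ω r) μ :=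
  integrable_mul_weight _ _ _ (f.continuous).norm (f.hasCompactSupport).norm

/-- The weighted norm `‖f‖_{1,ω} = ∫ ‖f(r)‖ ω(r) dr` on `C_c(G, A)`. -/
def WCc.seminorm : AddGroupSeminorm (WCc μ α ω) where
  toFun f := ∫ r, ‖f r‖ * ω r ∂μ
  map_zero' := by
    have : ∀ r, (0 : WCc μ α ω) r = 0 := fun r => rfl
    simp [this]
  add_le' f g := by
    rw [← integral_add f.integrable g.integrable]
    refine integral_mono (f + g).integrable (f.integrable.add g.integrable) fun r => ?_
    change ‖f r + g r‖ * ω r ≤ ‖f r‖ * ω r + ‖g r‖ * ω r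
    rw [← add_mul]
    exact mul_le_mul_of_nonneg_right (norm_add_le _ _) (ω.nonneg' r)
  neg' f := by
    have : ∀ r, (-f) r = -(f r) := fun r => rfl
    simp [this]

instance : SeminormedAddCommGroup (WCc μ α ω) :=
  (WCc.seminorm μ α ω).toSeminormedAddCommGroup

theorem WCc.norm_def (f : WCc μ α ω) : ‖f‖ = ∫ r, ‖f r‖ * ω r ∂μ := rfl

instance : NormedSpace 𝕜 (WCc μ α ω) where
  norm_smul_le c f := by
    have : ∀ r, (c • f) r = c • f r := fun r => rfl
    simp only [WCc.norm_def, this, norm_smul, mul_assoc, integral_const_mul]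
    exact le_rfl

section Conv

variable [NormedSpace ℝ A]

theorem conv_norm_le (f g : C_c(G, A)) {C : ℝ} (hC : ∀ s, ‖α s‖ ≤ C) :
    ∫ s, ‖conv μ α f g s‖ * ω s ∂μ ≤
      C * (∫ r, ‖f r‖ * ω r ∂μ) * ∫ r, ‖g r‖ * ω r ∂μ := by
  have hC0 : 0 ≤ C := (norm_nonneg _).trans (hC 1)
  let ν : Measure G := μ.withDensity fun s => ENNReal.ofReal (ω s)
  have hωm : Measurable fun s => ENNReal.ofReal (ω s) := ω.measurable'.ennreal_ofReal
  have hν : ∀ h : G → ℝ, ∫ s, h s ∂ν = ∫ s, h s * ω s ∂μ := by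
    intro h
    rw [integral_withDensity_eq_integral_toReal_smul hωm (by simp)]
    simp only [ENNReal.toReal_ofReal (ω.nonneg' _), smul_eq_mul, mul_comm]
  have hνfin : IsFiniteMeasureOnCompacts ν := by
    refine ⟨fun K hK => ?_⟩
    obtain ⟨D, hD⟩ := ω.bddOn_compact hK
    have hcl : MeasurableSet (closure K) := isClosed_closure.measurableSet
    obtain ⟨D, hD⟩ := ω.bddOn_compact hK.closure
    refine (measure_mono subset_closure).trans_lt ?_
    rw [withDensity_apply _ hcl]
    calc ∫⁻ s in closure K, ENNReal.ofReal (ω s) ∂μ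
        ≤ ∫⁻ s in closure K, ENNReal.ofReal D ∂μ :=
          setLIntegral_mono' hcl fun s hs => ENNReal.ofReal_le_ofReal (hD s hs)
      _ < ⊤ := by
          rw [setLIntegral_const]
          exact ENNReal.mul_lt_top ENNReal.ofReal_lt_top hK.closure.measure_lt_top
  let F : G → G → ℝ := fun s r => ‖f r‖ * ‖g (r⁻¹ * s)‖
  have hFc : Continuous F.uncurry := by
    refine ((f.continuous.comp continuous_snd).norm).mul ?_
    exact (g.continuous.comp (continuous_snd.inv.mul continuous_fst)).norm
  have hFs : HasCompactSupport F.uncurry := by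
    have hf := f.hasCompactSupport
    have hg := g.hasCompactSupport
    refine HasCompactSupport.intro'
      (K := (fun p : G × G => (p.1 * p.2, p.1)) '' (tsupport f ×ˢ tsupport g))
      ((hf.isCompact.prod hg.isCompact).image (by fun_prop)) ?_ ?_
    · have : (fun p : G × G => (p.1 * p.2, p.1)) '' (tsupport f ×ˢ tsupport g) =
          (fun p : G × G => (p.2, p.2⁻¹ * p.1)) ⁻¹' (tsupport f ×ˢ tsupport g) := by
        ext ⟨s, r⟩
        constructor
        · rintro ⟨⟨a, b⟩, h, h'⟩
          simp only [Prod.mk.injEq] at h'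
          obtain ⟨rfl, rfl⟩ := h'
          simpa using h
        · intro h
          exact ⟨(r, r⁻¹ * s), h, by simp⟩
      rw [this]
      exact ((isClosed_tsupport _).prod (isClosed_tsupport _)).preimage (by fun_prop)
    · rintro ⟨s, r⟩ h
      by_contra h0
      refine h ⟨(r, r⁻¹ * s), ⟨subset_tsupport _ fun h1 => h0 ?_,
        subset_tsupport _ fun h1 => h0 ?_⟩, by simp⟩
      · simp [F, h1]
      · simp [F, h1]
  have hFi : Integrable (fun s => ∫ r, F s r ∂μ) ν := by
    refine Continuous.integrable_of_hasCompactSupport ?_ ?_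
    · rw [← continuousOn_univ]
      refine continuousOn_integral_of_compact_support f.hasCompactSupport hFc.continuousOn ?_
      intro s r _ hr
      simp [F, image_eq_zero_of_notMem_tsupport hr]
    · refine HasCompactSupport.intro'
        (f.hasCompactSupport.isCompact.mul g.hasCompactSupport.isCompact)
        ((isClosed_tsupport _).mul_left_of_isCompact f.hasCompactSupport) ?_
      intro s hs
      refine integral_eq_zero_of_ae (Eventually.of_forall fun r => ?_)
      by_contra h
      refine hs ⟨r, subset_tsupport _ fun h1 => h ?_, r⁻¹ * s,
        subset_tsupport _ fun h1 => h ?_, by simp⟩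
      · simp [F, h1]
      · simp [F, h1]
  have hpt : ∀ s, ‖conv μ α f g s‖ ≤ C * ∫ r, F s r ∂μ := by
    intro s
    rw [conv_apply, ← integral_const_mul]
    have hFsr : Integrable (fun r => C * F s r) μ := by
      refine Integrable.const_mul ?_ _
      refine Continuous.integrable_of_hasCompactSupport
        (hFc.comp (Continuous.prodMk_right s)) ?_
      exact f.hasCompactSupport.mono fun r hr h1 => hr (by simp [F, h1])
    refine norm_integral_le_of_norm_le hFsr (Eventually.of_forall fun r => ?_)
    calc ‖f r * α r (g (r⁻¹ * s))‖ ≤ ‖f r‖ * ‖α r (g (r⁻¹ * s))‖ := norm_mul_le _ _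
      _ ≤ ‖f r‖ * (C * ‖g (r⁻¹ * s)‖) :=
          mul_le_mul_of_nonneg_left ((α r).le_of_opNorm_le (hC r) _) (norm_nonneg _)
      _ = C * F s r := by simp only [F]; ring
  have hinner : ∀ r, ∫ s, F s r ∂ν ≤ (‖f r‖ * ω r) * ∫ s, ‖g s‖ * ω s ∂μ := by
    intro r
    rw [hν, ← integral_const_mul,
      ← integral_mul_left_eq_self (fun s => F s r * ω s) r]
    have hg := integrable_mul_weight μ ω (fun s => ‖g s‖) g.continuous.norm
      g.hasCompactSupport.norm
    refine integral_mono_of_nonneg (Eventually.of_forall fun s => ?_)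
      (hg.const_mul _) (Eventually.of_forall fun s => ?_)
    · exact mul_nonneg (mul_nonneg (norm_nonneg _) (norm_nonneg _)) (ω.nonneg' _)
    · simp only [F, inv_mul_cancel_left]
      calc ‖f r‖ * ‖g s‖ * ω (r * s) ≤ ‖f r‖ * ‖g s‖ * (ω r * ω s) :=
            mul_le_mul_of_nonneg_left (ω.submul' r s) (by positivity)
        _ = ‖f r‖ * ω r * (‖g s‖ * ω s) := by ring
  have hconv := integrable_mul_weight μ ω (fun s => ‖conv μ α f g s‖)
      (conv μ α f g).continuous.norm (conv μ α f g).hasCompactSupport.norm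
  calc ∫ s, ‖conv μ α f g s‖ * ω s ∂μ = ∫ s, ‖conv μ α f g s‖ ∂ν := (hν _).symm
    _ ≤ ∫ s, C * ∫ r, F s r ∂μ ∂ν :=
        integral_mono_of_nonneg (Eventually.of_forall fun s => norm_nonneg _)
          (hFi.const_mul C) (Eventually.of_forall hpt)
    _ = C * ∫ r, ∫ s, F s r ∂ν ∂μ := by
        rw [integral_const_mul, integral_integral_swap_of_hasCompactSupport hFc hFs]
    _ ≤ C * ∫ r, (‖f r‖ * ω r) * ∫ s, ‖g s‖ * ω s ∂μ ∂μ := by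
        refine mul_le_mul_of_nonneg_left ?_ hC0
        refine integral_mono_of_nonneg (Eventually.of_forall fun r => integral_nonneg fun s => ?_)
          ?_ (Eventually.of_forall hinner)
        · exact mul_nonneg (norm_nonneg _) (norm_nonneg _)
        · exact (integrable_mul_weight μ ω (fun s => ‖f s‖) f.continuous.norm
            f.hasCompactSupport.norm).mul_const _
    _ = _ := by rw [integral_mul_const, mul_assoc]

variable [IsScalarTower 𝕜 A A] [SMulCommClass 𝕜 A A] [IsScalarTower ℝ 𝕜 A]

theorem conv_add_left (f f' g : C_c(G, A)) :
    conv μ α (f + f') g = conv μ α f g + conv μ α f' g := by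
  ext s
  simp only [conv_apply, CompactlySupportedContinuousMap.add_apply, add_mul]
  exact integral_add (conv_integrable μ α f g s) (conv_integrable μ α f' g s)

theorem conv_add_right (f g g' : C_c(G, A)) :
    conv μ α f (g + g') = conv μ α f g + conv μ α f g' := by
  ext s
  simp only [conv_apply, CompactlySupportedContinuousMap.add_apply, map_add, mul_add]
  exact integral_add (conv_integrable μ α f g s) (conv_integrable μ α f g' s)

theorem conv_smul_left (c : 𝕜) (f g : C_c(G, A)) :
    conv μ α (c • f) g = c • conv μ α f g := by
  ext s
  simp only [conv_apply, CompactlySupportedContinuousMap.smul_apply, smul_mul_assoc]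
  exact integral_smul c _

theorem conv_smul_right (c : 𝕜) (f g : C_c(G, A)) :
    conv μ α f (c • g) = c • conv μ α f g := by
  ext s
  simp only [conv_apply, CompactlySupportedContinuousMap.smul_apply, map_smul, mul_smul_comm]
  exact integral_smul c _

/-- Twisted convolution as a bounded bilinear map for the weighted norm. -/
def convL : WCc μ α ω →L[𝕜] WCc μ α ω →L[𝕜] WCc μ α ω :=
  LinearMap.mkContinuousOfExistsBound₂
    (LinearMap.mk₂ 𝕜 (fun f g : WCc μ α ω => toWCc μ α ω (conv μ α f g))
      (conv_add_left μ α) (conv_smul_left μ α) (conv_add_right μ α) (conv_smul_right μ α))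
    (by
      obtain ⟨C, hC⟩ := α.bdd'
      exact ⟨C, fun f g => conv_norm_le μ α ω f g hC⟩)

theorem convL_apply (f g : C_c(G, A)) :
    convL μ α ω (toWCc μ α ω f) (toWCc μ α ω g) = toWCc μ α ω (conv μ α f g) := rfl

end Conv

/-- The generalized Beurling algebra `L¹(G, A, ω; α)`: the completion of `C_c(G, A)` for the norm
`‖·‖_{1,ω}`, with the continuous extension of twisted convolution as multiplication. -/
abbrev GenBeurling : Type _ := UniformSpace.Completion (WCc μ α ω)

/-- The canonical map `C_c(G, A) → L¹(G, A, ω; α)`. -/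
def toL1 (f : C_c(G, A)) : GenBeurling μ α ω := ((toWCc μ α ω f : WCc μ α ω) : GenBeurling μ α ω)

section Mul

variable [NormedSpace ℝ A] [IsScalarTower 𝕜 A A] [SMulCommClass 𝕜 A A] [IsScalarTower ℝ 𝕜 A]

open UniformSpace.Completion in
instance : Mul (GenBeurling μ α ω) :=
  ⟨Function.curry <|
    (isDenseInducing_coe.prodMap isDenseInducing_coe).extend
      fun p : WCc μ α ω × WCc μ α ω => (convL μ α ω p.1 p.2 : GenBeurling μ α ω)⟩

open UniformSpace.Completion in
theorem GenBeurling.continuous_mul :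
    Continuous fun p : GenBeurling μ α ω × GenBeurling μ α ω => p.1 * p.2 := by
  let m : WCc μ α ω →+ WCc μ α ω →+ GenBeurling μ α ω :=
    { toFun := fun f => (toCompl (α := WCc μ α ω)).comp
        (convL μ α ω f : WCc μ α ω →ₗ[𝕜] WCc μ α ω).toAddMonoidHom
      map_zero' := by
        ext g
        exact congrArg toCompl (DFunLike.congr_fun (map_zero (convL μ α ω)) g)
      map_add' := fun f f' => by
        ext g
        exact (congrArg toCompl (DFunLike.congr_fun (map_add (convL μ α ω) f f') g)).trans
          (coe_add _ _) }
  have hm : Continuous fun p : WCc μ α ω × WCc μ α ω => m p.1 p.2 :=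
    (continuous_coe _).comp (convL μ α ω).continuous₂
  have di : IsDenseInducing (toCompl : WCc μ α ω → GenBeurling μ α ω) := isDenseInducing_coe
  exact (di.extend_Z_bilin di hm :)

open UniformSpace.Completion in
/-- The multiplication of `L¹(G, A, ω; α)` extends twisted convolution on `C_c(G, A)`. -/
theorem GenBeurling.toL1_mul (f g : C_c(G, A)) :
    toL1 μ α ω f * toL1 μ α ω g = toL1 μ α ω (conv μ α f g) :=
  (isDenseInducing_coe.prodMap isDenseInducing_coe).extend_eq
    ((continuous_coe _).comp (convL μ α ω).continuous₂)
    (toWCc μ α ω f, toWCc μ α ω g)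

end Mul

end Spaces

section Reconstruction

variable {G A : Type*} [Group G] [TopologicalSpace G] [IsTopologicalGroup G]
  [NonUnitalNormedRing A] [NormedSpace ℝ A]

/-- The function `z ⊗ a : r ↦ z(r) a`. -/
def tensor (z : C_c(G, ℝ)) (a : A) : C_c(G, A) where
  toFun r := z r • a
  continuous_toFun := z.continuous.smul continuous_const
  hasCompactSupport' := z.hasCompactSupport.smul_right

/-- The function `z(· s⁻¹) : r ↦ z(r s⁻¹)`. -/
def transR (z : C_c(G, ℝ)) (s : G) : C_c(G, ℝ) where
  toFun r := z (r * s⁻¹)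
  continuous_toFun := z.continuous.comp (continuous_mul_const s⁻¹)
  hasCompactSupport' := z.hasCompactSupport.comp_homeomorph (Homeomorph.mulRight s⁻¹)

/-- The function `f^∨ : r ↦ Δ(r⁻¹) α_r(f(r))`. -/
def check {𝕜 : Type*} [RCLike 𝕜] [LocallyCompactSpace G] [NormedSpace 𝕜 A]
    (α : BddDynSystem 𝕜 G A) (f : C_c(G, A)) : C_c(G, A) where
  toFun r := modulus r⁻¹ • α r (f r)
  continuous_toFun := by
    borelize G
    exact (continuous_modulus.comp continuous_inv).smul
      (α.continuous_uncurry.comp (continuous_id.prodMk f.continuous))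
  hasCompactSupport' := f.hasCompactSupport.mono fun r hr h0 => hr (by simp [h0])

end Reconstruction

section Objects

variable {I A : Type*} [Preorder I] [NonUnitalNormedRing A]

/-- `u` is a bounded approximate right identity of `A`: `a u_i → a` for all `a`. -/
structure IsBddApproxRightId (u : I → A) : Prop where
  tendsto : ∀ a, Tendsto (fun i => a * u i) atTop (𝓝 a)
  bdd : ∃ M : ℝ, ∀ i, ‖u i‖ ≤ M

/-- `u` is a bounded two-sided approximate identity of `A`. -/
structure IsBddApproxId (u : I → A) : Prop extends IsBddApproxRightId u where
  tendsto_left : ∀ a, Tendsto (fun i => u i * a) atTop (𝓝 a)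

/-- `𝒵` is a neighbourhood base of `e`, all of whose elements lie in one compact set. -/
structure IsCompactNhdBase {G : Type*} [Group G] [TopologicalSpace G] (𝒵 : Set (Set G)) :
    Prop where
  mem_nhds : ∀ V ∈ 𝒵, V ∈ 𝓝 (1 : G)
  base : ∀ W ∈ 𝓝 (1 : G), ∃ V ∈ 𝒵, V ⊆ W
  compact : ∃ K, IsCompact K ∧ ∀ V ∈ 𝒵, V ⊆ K

/-- A choice, for each `V ∈ 𝒵`, of a non-negative `z_V ∈ C_c(G)`, supported in `V`, with
`∫ z_V(r⁻¹) dr = 1`. -/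
structure IsBumpFamily {G : Type*} [Group G] [TopologicalSpace G] [MeasurableSpace G]
    (μ : Measure G) (𝒵 : Set (Set G)) (z : 𝒵 → C_c(G, ℝ)) : Prop where
  nonneg : ∀ V r, 0 ≤ z V r
  supp : ∀ V : 𝒵, Function.support (z V) ⊆ V
  integral_inv : ∀ V, ∫ r, z V r⁻¹ ∂μ = 1

variable {𝕜 G : Type*} [RCLike 𝕜] [Group G] [TopologicalSpace G] [MeasurableSpace G]
  [NormedSpace 𝕜 A]

/-- A linear map `π` from `B` to the bounded operators on `X` is non-degenerate if the span of
`π(B) X` is dense in `X`. -/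
def NonDegenerate {B X : Type*} [SeminormedAddCommGroup B] [NormedSpace 𝕜 B]
    [NormedAddCommGroup X] [NormedSpace 𝕜 X] (π : B →L[𝕜] (X →L[𝕜] X)) : Prop :=
  Dense (Submodule.span 𝕜 {y : X | ∃ b x, π b x = y} : Set X)

/-- The pairs `(π, U)` of type `(a, a)`: `π` is a non-degenerate bounded anti-representation of `A`
on `X`, `U` is a strongly continuous anti-representation of `G` on `X`,
`U_r π(a) U_r⁻¹ = π(α_{r⁻¹}(a))`, and `‖U_r‖ ≤ C ω(r)` for some constant `C` and all `r`. -/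
structure AAPair (α : BddDynSystem 𝕜 G A) (ω : Weight G) (X : Type*) [NormedAddCommGroup X]
    [NormedSpace 𝕜 X] where
  /-- the bounded anti-representation of `A` -/
  π : A →L[𝕜] (X →L[𝕜] X)
  /-- the strongly continuous anti-representation of `G` -/
  U : G → (X →L[𝕜] X)
  π_mul : ∀ a b, π (a * b) = π b * π a
  π_nondeg : NonDegenerate π
  U_one : U 1 = 1
  U_mul : ∀ r s, U (r * s) = U s * U r
  U_cont : ∀ x, Continuous fun r => U r x
  -- by `U_one` and `U_mul`, the inverse operator of `U r` is `U r⁻¹`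
  covariant : ∀ r a, U r * π a * U r⁻¹ = π (α r⁻¹ a)
  U_bdd : ∃ C : ℝ, ∀ r, ‖U r‖ ≤ C * ω r

/-- The non-degenerate bounded anti-representations of `L¹(G, A, ω; α)` on `X`. -/
structure AntiRep [IsTopologicalGroup G] [LocallyCompactSpace G] [BorelSpace G]
    [NormedSpace ℝ A] [IsScalarTower 𝕜 A A] [SMulCommClass 𝕜 A A] [IsScalarTower ℝ 𝕜 A]
    (μ : Measure G) [μ.IsHaarMeasure] (α : BddDynSystem 𝕜 G A) (ω : Weight G)
    (X : Type*) [NormedAddCommGroup X] [NormedSpace 𝕜 X] where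
  /-- the bounded linear map -/
  T : GenBeurling μ α ω →L[𝕜] (X →L[𝕜] X)
  T_mul : ∀ f g, T (f * g) = T g * T f
  T_nondeg : NonDegenerate T

end Objects

end BeurlingAnti

/-! Formally, an anti-representation `T` of the algebra extends to the operators commuting with all
left convolutions. Two families matter: `f ↦ (r ↦ f(r) α_r(a))`, which is right convolution by `a
δ_e`, and `f ↦ (r ↦ Δ(s⁻¹) f(r s⁻¹))`, which is right convolution by `δ_s`. The values of the
extended `T` on these two families are `π(a)` and `U_s`.

Integration of a pair is a well-defined map by Fubini and covariance (`integratedCc_conv`). It is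
injective because the pair can be read off: by `integrated_check_tensor`, `T((z_V(· s⁻¹) ⊗ b)^∨) x`
equals `π(b)` applied to an average of `r ↦ U_{rs} x` against the probability density `Δ(r⁻¹)
z_V(r)`. As `V` shrinks this tends to `π(b) U_s x`, and a bounded approximate right identity in the
place of `b` removes `π(b)`.

It is surjective by the multiplier construction. The functions `e = z_V ⊗ u_i` form a bounded
approximate right identity for convolution, and for an operator `R` commuting with left convolutions
`T(R e) T(f) = T(f * R e) = T(R(f * e)) → T(R f)`. With non-degeneracy this gives a bounded operator
`S` with `S T(f) = T(R f)` (`exists_multiplier_operator`). The relations between `π` and `U` are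
identities between multipliers, and `g * f = ∫ R_r M_{f(r)} g dr`, with `R_r` the translation and
`M_a` the multiplication, shows that the pair integrates to `T` (`exists_pair`).

The limit formulas and the bounds on `π^T` and `U^T` need no separate analysis of `T`: once `T` is
known to come from a pair, they follow from the same averaging formula and a norm estimate of the
test functions. -/

namespace BeurlingAnti

/-! ### Right translation and inversion under Haar measure. -/

section Haar

variable {G : Type*} [Group G] [TopologicalSpace G] [IsTopologicalGroup G]
  [LocallyCompactSpace G]

theorem modulus_pos (s : G) : 0 < modulus s :=
  NNReal.coe_pos.2 (Measure.modularCharacterFun_pos _)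

theorem modulus_mul (s t : G) : modulus (s * t) = modulus s * modulus t := by
  simp [modulus, Measure.modularCharacterFun_map_mul, mul_comm]

theorem modulus_one : modulus (1 : G) = 1 := by
  simp [modulus, Measure.modularCharacterFun_map_one]

theorem modulus_mul_modulus_inv (s : G) : modulus s * modulus s⁻¹ = 1 := by
  rw [← modulus_mul, mul_inv_cancel, modulus_one]

variable [MeasurableSpace G] [BorelSpace G] (μ : Measure G) [μ.IsHaarMeasure] [μ.Regular]

theorem map_mul_right_eq (s : G) :
    Measure.map (· * s) μ = Measure.modularCharacterFun s • μ := by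
  have : (Measure.map (· * s) μ).Regular := Measure.Regular.map (Homeomorph.mulRight s)
  rw [Measure.modularCharacterFun_eq_haarScalarFactor μ _]
  exact Measure.isMulLeftInvariant_eq_smul_of_regular _ μ

theorem integral_mul_right_eq {E : Type*} [NormedAddCommGroup E] [NormedSpace ℝ E]
    (f : G → E) (s : G) : ∫ r, f (r * s) ∂μ = modulus s⁻¹ • ∫ r, f r ∂μ := by
  have h := (Homeomorph.mulRight s).measurableEmbedding.integral_map (μ := μ) f
  refine h.symm.trans ?_
  change ∫ r, f r ∂(Measure.map (· * s) μ) = _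
  rw [map_mul_right_eq, integral_smul_nnreal_measure, modulus, inv_inv]
  rfl

theorem integrable_mul_right {E : Type*} [NormedAddCommGroup E]
    {f : G → E} (hf : Integrable f μ) (s : G) : Integrable (fun r => f (r * s)) μ := by
  have h : Integrable f (Measure.map (· * s) μ) := by
    rw [map_mul_right_eq]
    exact hf.smul_measure_nnreal
  exact ((Homeomorph.mulRight s).measurableEmbedding.integrable_map_iff).1 h

theorem hasCompactSupport_uncurry_of_subset {P Q E : Type*} [TopologicalSpace P]
    [TopologicalSpace Q] [T2Space P] [T2Space Q] [Zero E] {F : P → Q → E} {K : Set P} {L : Set Q}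
    (hK : IsCompact K) (hL : IsCompact L) (h : ∀ p q, F p q ≠ 0 → p ∈ K ∧ q ∈ L) :
    HasCompactSupport F.uncurry :=
  HasCompactSupport.intro (hK.prod hL) fun p hp => by
    by_contra h0
    exact hp (h p.1 p.2 h0)

/-- The integral of `f(x) g(y⁻¹ x)` over `G × G` is computed in two ways, for an auxiliary `f ≥ 0`
with `∫ f ≠ 0`. Integrating over `y` first gives `(∫ f) ∫ g(y⁻¹) dy`; substituting `x ↦ y x` and
integrating over `y` first gives `(∫ f) ∫ Δ(x⁻¹) g(x) dx`. Then `∫ f` is cancelled. -/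
theorem integral_inv_eq_integral_modulus [T2Space G] {E : Type*} [NormedAddCommGroup E]
    [NormedSpace ℝ E] [CompleteSpace E] {g : G → E} (hg : Continuous g) (hgs : HasCompactSupport g) :
    ∫ r, g r⁻¹ ∂μ = ∫ r, modulus r⁻¹ • g r ∂μ := by
  obtain ⟨⟨f, f_cont⟩, f_comp, f_nonneg, f_one⟩ :
    ∃ f : C(G, ℝ), HasCompactSupport f ∧ 0 ≤ f ∧ f 1 ≠ 0 := exists_continuous_nonneg_pos 1
  have hpos : 0 < ∫ r, f r ∂μ :=
    f_cont.integral_pos_of_hasCompactSupport_nonneg_nonzero f_comp f_nonneg f_one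
  replace f_comp : HasCompactSupport f := f_comp
  have hK : IsCompact (tsupport f * (tsupport g)⁻¹) := f_comp.isCompact.mul hgs.isCompact.inv
  have h1 : ∫ x, ∫ y, f x • g (y⁻¹ * x) ∂μ ∂μ = (∫ x, f x ∂μ) • ∫ y, g y⁻¹ ∂μ := by
    have : ∀ x, ∫ y, f x • g (y⁻¹ * x) ∂μ = f x • ∫ y, g y⁻¹ ∂μ := by
      intro x
      rw [integral_smul, ← integral_mul_left_eq_self (fun y => g (y⁻¹ * x)) x]
      simp
    simp only [this]
    rw [integral_smul_const]
  have h2 : ∫ x, ∫ y, f x • g (y⁻¹ * x) ∂μ ∂μ = ∫ y, ∫ x, f (y * x) • g x ∂μ ∂μ := by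
    rw [integral_integral_swap_of_hasCompactSupport]
    · congr 1
      ext y
      rw [← integral_mul_left_eq_self (fun x => f x • g (y⁻¹ * x)) y]
      simp
    · simp only [Function.uncurry_def]
      fun_prop
    · refine hasCompactSupport_uncurry_of_subset f_comp.isCompact hK fun x y h => ?_
      have hx : x ∈ tsupport f := subset_tsupport _ (left_ne_zero_of_smul h)
      refine ⟨hx, Set.mem_mul.2 ⟨x, hx, x⁻¹ * y, ?_, by simp⟩⟩
      simpa using subset_tsupport g (right_ne_zero_of_smul h)
  have h3 : ∫ y, ∫ x, f (y * x) • g x ∂μ ∂μ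
      = (∫ x, f x ∂μ) • ∫ x, modulus x⁻¹ • g x ∂μ := by
    rw [integral_integral_swap_of_hasCompactSupport]
    · rw [← integral_smul]
      congr 1
      ext x
      rw [integral_smul_const, integral_mul_right_eq, smul_eq_mul, smul_smul, mul_comm]
    · simp only [Function.uncurry_def]
      fun_prop
    · refine hasCompactSupport_uncurry_of_subset hK hgs.isCompact fun y x h => ?_
      have hx : x ∈ tsupport g := subset_tsupport _ (right_ne_zero_of_smul h)
      have hy : y * x ∈ tsupport f := subset_tsupport _ (left_ne_zero_of_smul h)
      exact ⟨Set.mem_mul.2 ⟨y * x, hy, x⁻¹, by simpa using hx, by simp⟩, hx⟩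
  exact smul_right_injective E hpos.ne' (h1.symm.trans (h2.trans h3))

end Haar

/-- Divide `ω(s) ≤ ω(s) ω(1)` by some `ω(s) > 0`. Positivity of `ω(1)` is what forces every constant
`C_U` to be non-negative. -/
theorem Weight.one_le_one {G : Type*} [Group G] [MeasurableSpace G] (ω : Weight G) : 1 ≤ ω 1 := by
  obtain ⟨s, hs⟩ := ω.ne_zero'
  have hs' : 0 < ω s := lt_of_le_of_ne (ω.nonneg' s) (Ne.symm hs)
  have := ω.submul' s 1
  rw [mul_one] at this
  exact le_of_mul_le_mul_left (by rwa [mul_one]) hs'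

/-! ### Covariant pairs and their integrated form on `C_c(G, A)`. -/

section Pair

variable {𝕜 G A X : Type*} [RCLike 𝕜] [Group G] [TopologicalSpace G] [IsTopologicalGroup G]
  [LocallyCompactSpace G] [MeasurableSpace G] [BorelSpace G]
  [NonUnitalNormedRing A] [NormedSpace 𝕜 A] [NormedAddCommGroup X] [NormedSpace 𝕜 X]
  {α : BddDynSystem 𝕜 G A} {ω : Weight G}

theorem BddDynSystem.inv_apply_apply (α : BddDynSystem 𝕜 G A) (s : G) (a : A) :
    α s⁻¹ (α s a) = a := by
  have : (α.toHom s⁻¹ * α.toHom s) a = a := by rw [← map_mul]; simp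
  exact this

namespace AAPair

theorem ext_apply {P Q : AAPair α ω X} (hπ : ∀ a x, P.π a x = Q.π a x)
    (hU : ∀ s x, P.U s x = Q.U s x) : P = Q := by
  have h1 : P.π = Q.π := ContinuousLinearMap.ext fun a => ContinuousLinearMap.ext (hπ a)
  have h2 : P.U = Q.U := funext fun s => ContinuousLinearMap.ext (hU s)
  cases P; cases Q
  simp only at h1 h2
  subst h1 h2
  rfl

theorem nonneg_of_norm_le (P : AAPair α ω X) {C : ℝ} (hC : ∀ r, ‖P.U r‖ ≤ C * ω r) : 0 ≤ C :=
  nonneg_of_mul_nonneg_left ((norm_nonneg _).trans (hC 1)) (one_pos.trans_le ω.one_le_one)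

/-- Strong continuity becomes joint continuity because `U` is locally bounded: `‖U_r‖ ≤ C ω(r)`, and
weights are bounded on compact sets. -/
theorem continuous_uncurry (P : AAPair α ω X) : Continuous fun p : G × X => P.U p.1 p.2 := by
  obtain ⟨C, hC⟩ := P.U_bdd
  have hC0 := P.nonneg_of_norm_le hC
  rw [continuous_iff_continuousAt]
  rintro ⟨r, a⟩
  obtain ⟨N, hN, hrN⟩ := exists_compact_mem_nhds r
  obtain ⟨D, hD⟩ := ω.bddOn_compact hN
  have h1 : Tendsto (fun p : G × X => P.U p.1 (p.2 - a)) (𝓝 (r, a)) (𝓝 0) := by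
    refine squeeze_zero_norm' (a := fun p : G × X => C * D * ‖p.2 - a‖) ?_ ?_
    · filter_upwards [continuous_fst.continuousAt.preimage_mem_nhds
        (show N ∈ 𝓝 ((r, a) : G × X).1 from hrN)] with p hp
      exact (P.U p.1).le_of_opNorm_le
        ((hC p.1).trans (mul_le_mul_of_nonneg_left (hD _ hp) hC0)) _
    · have : Continuous fun p : G × X => C * D * ‖p.2 - a‖ := by fun_prop
      simpa using this.tendsto (r, a)
  have h2 : Tendsto (fun p : G × X => P.U p.1 a) (𝓝 (r, a)) (𝓝 (P.U r a)) :=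
    ((P.U_cont a).comp continuous_fst).tendsto (r, a)
  have := h1.add h2
  simpa [ContinuousAt] using this

theorem π_mul_apply (P : AAPair α ω X) (a b : A) (x : X) :
    P.π (a * b) x = P.π b (P.π a x) := by rw [P.π_mul]; rfl

theorem U_mul_apply (P : AAPair α ω X) (r s : G) (x : X) :
    P.U (r * s) x = P.U s (P.U r x) := by rw [P.U_mul]; rfl

/-- Covariance without inverses; this form cancels the twist `α_r` that occurs both in the
convolution and in `f^∨`. -/
theorem U_π (P : AAPair α ω X) (r : G) (a : A) (x : X) :
    P.U r (P.π (α r a) x) = P.π a (P.U r x) := by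
  have h := P.covariant r (α r a)
  rw [α.inv_apply_apply] at h
  have h2 := DFunLike.congr_fun h (P.U r x)
  simp only [ContinuousLinearMap.mul_def, ContinuousLinearMap.comp_apply] at h2
  rw [← h2, ← P.U_mul_apply, mul_inv_cancel, P.U_one]
  rfl

theorem continuous_integrand (P : AAPair α ω X) {f : G → A} (hf : Continuous f) (x : X) :
    Continuous fun r => P.U r (P.π (f r) x) :=
  P.continuous_uncurry.comp (continuous_id.prodMk
    ((P.π.continuous.comp hf).clm_apply continuous_const))

variable (μ : Measure G) [μ.IsHaarMeasure]

theorem integrable_integrand (P : AAPair α ω X) (f : WCc μ α ω) (x : X) :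
    Integrable (fun r => P.U r (P.π (f r) x)) μ :=
  (P.continuous_integrand f.continuous x).integrable_of_hasCompactSupport
    (f.hasCompactSupport.mono fun r hr h0 => hr (by simp [h0]))

variable [NormedSpace ℝ X] [IsScalarTower ℝ 𝕜 X]

theorem norm_integral_integrand_le (P : AAPair α ω X) {C : ℝ} (hC : ∀ r, ‖P.U r‖ ≤ C * ω r)
    (f : WCc μ α ω) (x : X) :
    ‖∫ r, P.U r (P.π (f r) x) ∂μ‖ ≤ C * ‖P.π‖ * ‖f‖ * ‖x‖ := by
  have hC0 := P.nonneg_of_norm_le hC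
  calc ‖∫ r, P.U r (P.π (f r) x) ∂μ‖ ≤ ∫ r, C * ‖P.π‖ * ‖x‖ * (‖f r‖ * ω r) ∂μ := by
        refine norm_integral_le_of_norm_le (f.integrable.const_mul _)
          (Eventually.of_forall fun r => ?_)
        calc ‖P.U r (P.π (f r) x)‖ ≤ C * ω r * ‖P.π (f r) x‖ :=
              (P.U r).le_of_opNorm_le (hC r) _
          _ ≤ C * ω r * (‖P.π‖ * ‖f r‖ * ‖x‖) := by
              refine mul_le_mul_of_nonneg_left ?_ (mul_nonneg hC0 (ω.nonneg' r))
              exact P.π.le_opNorm₂ _ _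
          _ = _ := by ring
    _ = _ := by rw [integral_const_mul, WCc.norm_def]; ring

/-- The integrated form `f ↦ ∫ U_r π(f(r)) dr` on `C_c(G, A)`. -/
def integratedCc (P : AAPair α ω X) : WCc μ α ω →L[𝕜] X →L[𝕜] X :=
  LinearMap.mkContinuousOfExistsBound₂
    (LinearMap.mk₂ 𝕜 (fun (f : WCc μ α ω) x => ∫ r, P.U r (P.π (f r) x) ∂μ)
      (fun f g x => by
        rw [← integral_add (P.integrable_integrand μ f x) (P.integrable_integrand μ g x)]
        congr 1
        ext r
        rw [show (f + g) r = f r + g r from rfl]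
        simp)
      (fun c f x => by
        rw [← integral_smul]
        congr 1
        ext r
        rw [show (c • f) r = c • f r from rfl]
        simp)
      (fun f x y => by
        rw [← integral_add (P.integrable_integrand μ f x) (P.integrable_integrand μ f y)]
        simp)
      (fun c f x => by
        rw [← integral_smul]
        simp))
    (by
      obtain ⟨C, hC⟩ := P.U_bdd
      exact ⟨C * ‖P.π‖, fun f x => P.norm_integral_integrand_le μ hC f x⟩)

theorem integratedCc_apply (P : AAPair α ω X) (f : WCc μ α ω) (x : X) :
    P.integratedCc μ f x = ∫ r, P.U r (P.π (f r) x) ∂μ := rfl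

theorem norm_integratedCc_le (P : AAPair α ω X) {C : ℝ} (hC : ∀ r, ‖P.U r‖ ≤ C * ω r)
    (f : WCc μ α ω) : ‖P.integratedCc μ f‖ ≤ C * ‖P.π‖ * ‖f‖ := by
  have hC0 := P.nonneg_of_norm_le hC
  exact ContinuousLinearMap.opNorm_le_bound _ (by positivity)
    fun x => P.norm_integral_integrand_le μ hC f x

end AAPair

end Pair

/-! ### Strong limits of bounded nets of operators. -/

section StrongLimits

variable {𝕜 X I : Type*} [RCLike 𝕜] [NormedAddCommGroup X] [NormedSpace 𝕜 X] {l : Filter I}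
  {S : I → X →L[𝕜] X} {C : ℝ} {D : Set X}

theorem tendsto_apply_of_tendsto (hS : ∀ i, ‖S i‖ ≤ C) {y : I → X} {x w : X}
    (hy : Tendsto y l (𝓝 x)) (hx : Tendsto (fun i => S i x) l (𝓝 w)) :
    Tendsto (fun i => S i (y i)) l (𝓝 w) := by
  have h1 : Tendsto (fun i => S i (y i - x)) l (𝓝 0) := by
    refine squeeze_zero_norm (a := fun i => C * ‖y i - x‖)
      (fun i => (S i).le_of_opNorm_le (hS i) _) ?_
    have := (tendsto_iff_norm_sub_tendsto_zero.1 hy).const_mul C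
    simpa using this
  simpa using h1.add hx

/-- By linearity convergence holds on the span of `D`; the uniform bound makes the net Cauchy at
every point of its closure, and `X` is complete. -/
theorem exists_tendsto_of_dense_span [CompleteSpace X] [l.NeBot] (hS : ∀ i, ‖S i‖ ≤ C)
    (hD : Dense (Submodule.span 𝕜 D : Set X))
    (h : ∀ x ∈ D, ∃ y, Tendsto (fun i => S i x) l (𝓝 y)) (x : X) :
    ∃ y, Tendsto (fun i => S i x) l (𝓝 y) := by
  have hspan : ∀ x ∈ Submodule.span 𝕜 D, ∃ y, Tendsto (fun i => S i x) l (𝓝 y) := by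
    intro x hx
    induction hx using Submodule.span_induction with
    | mem x hx => exact h x hx
    | zero => exact ⟨0, by simp⟩
    | add x y _ _ hx hy =>
      obtain ⟨a, ha⟩ := hx
      obtain ⟨b, hb⟩ := hy
      exact ⟨a + b, by simpa using ha.add hb⟩
    | smul c x _ hx =>
      obtain ⟨a, ha⟩ := hx
      exact ⟨c • a, by simpa using ha.const_smul c⟩
  obtain ⟨i₀⟩ : Nonempty I := l.nonempty_of_neBot
  have hC : 0 ≤ C := (norm_nonneg _).trans (hS i₀)
  refine cauchy_map_iff_exists_tendsto.1 (Metric.cauchy_iff.2 ⟨inferInstance, fun ε hε => ?_⟩)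
  -- The radius makes `‖S i (x - x')‖ ≤ ε / 4` for all `i`; the `+ 1` covers `C = 0`.
  obtain ⟨x', hx', hxx'⟩ := Metric.dense_iff.1 hD x (ε / (4 * (C + 1))) (by positivity)
  obtain ⟨y, hy⟩ := hspan x' hxx'
  refine ⟨_, image_mem_map (Metric.tendsto_nhds.1 hy (ε / 4) (by positivity)), ?_⟩
  have key : ∀ i, dist (S i x') y < ε / 4 → dist (S i x) y < ε / 2 := by
    intro i hi
    have h1 : dist (S i x) (S i x') ≤ C * (ε / (4 * (C + 1))) := by
      rw [dist_eq_norm, ← map_sub]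
      refine ((S i).le_of_opNorm_le (hS i) _).trans (mul_le_mul_of_nonneg_left ?_ hC)
      rw [← dist_eq_norm, dist_comm]
      exact (Metric.mem_ball.1 hx').le
    have h2 : C * (ε / (4 * (C + 1))) ≤ ε / 4 := by
      rw [mul_div_assoc', div_le_div_iff₀ (by positivity) (by positivity)]
      nlinarith
    linarith [dist_triangle (S i x) (S i x') y]
  rintro _ ⟨i, hi, rfl⟩ _ ⟨j, hj, rfl⟩
  linarith [dist_triangle_right (S i x) (S j x) y, key i hi, key j hj]

theorem exists_strong_limit [CompleteSpace X] [l.NeBot] (hS : ∀ i, ‖S i‖ ≤ C)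
    (hD : Dense (Submodule.span 𝕜 D : Set X))
    (h : ∀ x ∈ D, ∃ y, Tendsto (fun i => S i x) l (𝓝 y)) :
    ∃ R : X →L[𝕜] X, (∀ x, Tendsto (fun i => S i x) l (𝓝 (R x))) ∧ ‖R‖ ≤ C := by
  choose f hf using exists_tendsto_of_dense_span hS hD h
  obtain ⟨i₀⟩ : Nonempty I := l.nonempty_of_neBot
  have hC : 0 ≤ C := (norm_nonneg _).trans (hS i₀)
  refine ⟨ContinuousLinearMap.ofTendstoOfBoundedRange f S (tendsto_pi_nhds.2 hf)
    (isBounded_iff_forall_norm_le.2 ⟨C, by rintro _ ⟨i, rfl⟩; exact hS i⟩), hf, ?_⟩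
  refine ContinuousLinearMap.opNorm_le_bound _ hC fun x => ?_
  exact le_of_tendsto (hf x).norm (Eventually.of_forall fun i => (S i).le_of_opNorm_le (hS i) x)

theorem eq_of_dense_span {R R' : X →L[𝕜] X} (hD : Dense (Submodule.span 𝕜 D : Set X))
    (h : ∀ x ∈ D, R x = R' x) : R = R' :=
  ContinuousLinearMap.ext_on hD h

theorem tendsto_of_dense_span [CompleteSpace X] (hS : ∀ i, ‖S i‖ ≤ C)
    (hD : Dense (Submodule.span 𝕜 D : Set X)) {R : X →L[𝕜] X}
    (h : ∀ x ∈ D, Tendsto (fun i => S i x) l (𝓝 (R x))) (x : X) :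
    Tendsto (fun i => S i x) l (𝓝 (R x)) := by
  rcases l.eq_or_neBot with rfl | hl
  · exact tendsto_bot
  obtain ⟨R', hR', -⟩ := exists_strong_limit hS hD fun x hx => ⟨_, h x hx⟩
  rw [eq_of_dense_span hD fun x hx => tendsto_nhds_unique (h x hx) (hR' x)]
  exact hR' x

end StrongLimits

/-! ### Averages against probability densities. -/

section Averages

variable {G E : Type*} [TopologicalSpace G] [MeasurableSpace G] [BorelSpace G] {μ : Measure G}
  [IsFiniteMeasureOnCompacts μ] [NormedAddCommGroup E] [NormedSpace ℝ E] [CompleteSpace E]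

theorem norm_integral_smul_sub_le {p : G → ℝ} (hp : Continuous p) (hps : HasCompactSupport p)
    (hp0 : ∀ r, 0 ≤ p r) (hp1 : ∫ r, p r ∂μ = 1) {F : G → E} (hF : Continuous F) {y : E} {ε : ℝ}
    (hε : ∀ r, p r ≠ 0 → ‖F r - y‖ ≤ ε) : ‖∫ r, p r • F r ∂μ - y‖ ≤ ε := by
  have hpi : Integrable p μ := hp.integrable_of_hasCompactSupport hps
  have h1 : Integrable (fun r => p r • F r) μ :=
    (hp.smul hF).integrable_of_hasCompactSupport hps.smul_right
  have h2 : ∫ r, p r • F r ∂μ - y = ∫ r, p r • (F r - y) ∂μ := by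
    simp only [smul_sub]
    rw [integral_sub h1 (hpi.smul_const y), integral_smul_const, hp1, one_smul]
  calc ‖∫ r, p r • F r ∂μ - y‖ ≤ ∫ r, p r * ε ∂μ := by
        rw [h2]
        refine norm_integral_le_of_norm_le (hpi.mul_const ε) (Eventually.of_forall fun r => ?_)
        rw [norm_smul, Real.norm_of_nonneg (hp0 r)]
        by_cases h : p r = 0
        · simp [h]
        · exact mul_le_mul_of_nonneg_left (hε r h) (hp0 r)
    _ = ε := by rw [integral_mul_const, hp1, one_mul]

end Averages

/-! ### Neighbourhood bases of the identity and bump functions. -/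

section NhdBase

variable {G : Type*} [Group G] [TopologicalSpace G] {𝒵 : Set (Set G)}

theorem IsCompactNhdBase.nonempty (h : IsCompactNhdBase 𝒵) : Nonempty (↥𝒵)ᵒᵈ := by
  obtain ⟨V, hV, -⟩ := h.base Set.univ univ_mem
  exact ⟨OrderDual.toDual ⟨V, hV⟩⟩

theorem IsCompactNhdBase.isDirected (h : IsCompactNhdBase 𝒵) :
    IsDirected (↥𝒵)ᵒᵈ (· ≤ ·) := by
  refine ⟨fun V W => ?_⟩
  obtain ⟨U, hU, hUVW⟩ := h.base _ (inter_mem (h.mem_nhds _ (OrderDual.ofDual V).2)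
    (h.mem_nhds _ (OrderDual.ofDual W).2))
  exact ⟨OrderDual.toDual ⟨U, hU⟩, fun r hr => (hUVW hr).1, fun r hr => (hUVW hr).2⟩

theorem IsCompactNhdBase.eventually_subset (h : IsCompactNhdBase 𝒵) {W : Set G}
    (hW : W ∈ 𝓝 (1 : G)) : ∀ᶠ V : (↥𝒵)ᵒᵈ in atTop, ((OrderDual.ofDual V : 𝒵) : Set G) ⊆ W := by
  obtain ⟨V, hV, hVW⟩ := h.base W hW
  filter_upwards [mem_atTop (OrderDual.toDual (⟨V, hV⟩ : 𝒵))] with U hU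
  have : ((OrderDual.ofDual U : 𝒵) : Set G) ⊆ V := hU
  exact this.trans hVW

theorem IsCompactNhdBase.neBot (h : IsCompactNhdBase 𝒵) :
    (atTop : Filter (↥𝒵)ᵒᵈ).NeBot := by
  have := h.nonempty
  have := h.isDirected
  infer_instance

variable (G) in
theorem exists_isCompactNhdBase [LocallyCompactSpace G] :
    ∃ 𝒵 : Set (Set G), IsCompactNhdBase 𝒵 := by
  obtain ⟨K, hK, hK1⟩ := exists_compact_mem_nhds (1 : G)
  exact ⟨{V | V ∈ 𝓝 1 ∧ V ⊆ K}, fun V hV => hV.1,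
    fun W hW => ⟨W ∩ K, ⟨inter_mem hW hK1, Set.inter_subset_right⟩, Set.inter_subset_left⟩,
    K, hK, fun V hV => hV.2⟩

variable [IsTopologicalGroup G] [LocallyCompactSpace G] [T2Space G]
  [MeasurableSpace G] [BorelSpace G] (μ : Measure G) [μ.IsHaarMeasure] [μ.Regular]

theorem exists_isBumpFamily (h : IsCompactNhdBase 𝒵) :
    ∃ z : 𝒵 → C_c(G, ℝ), IsBumpFamily μ 𝒵 z := by
  have key : ∀ V : 𝒵, ∃ z : C_c(G, ℝ), (∀ r, 0 ≤ z r) ∧ Function.support z ⊆ V ∧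
      ∫ r, z r⁻¹ ∂μ = 1 := by
    intro V
    have hV : interior (V : Set G) ∈ 𝓝 1 := interior_mem_nhds.2 (h.mem_nhds V V.2)
    obtain ⟨f, hf1, hf2, hf3, hf4⟩ := exists_continuous_one_zero_of_isCompact
      (isCompact_singleton (x := (1 : G))) isOpen_interior.isClosed_compl
      (Set.disjoint_compl_right_iff_subset.2 (Set.singleton_subset_iff.2 (mem_of_mem_nhds hV)))
    have hpos : 0 < ∫ r, f r⁻¹ ∂μ := by
      refine (f.continuous.comp continuous_inv).integral_pos_of_hasCompactSupport_nonneg_nonzero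
        (hf3.comp_homeomorph (Homeomorph.inv G)) (fun r => (hf4 _).1) (x := 1) ?_
      simp [hf1 (Set.mem_singleton 1)]
    refine ⟨⟨⟨fun r => (∫ r, f r⁻¹ ∂μ)⁻¹ * f r, by fun_prop⟩, hf3.mul_left⟩, fun r => ?_, ?_, ?_⟩
    · exact mul_nonneg (inv_nonneg.2 hpos.le) (hf4 r).1
    · intro r hr
      by_contra hrV
      refine hr ?_
      have : f r = 0 := hf2 fun h => hrV (interior_subset h)
      change _ * f r = 0
      rw [this, mul_zero]
    · change ∫ r, (∫ r, f r⁻¹ ∂μ)⁻¹ * f r⁻¹ ∂μ = 1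
      rw [integral_const_mul, inv_mul_cancel₀ hpos.ne']
  choose z hz using key
  exact ⟨z, fun V => (hz V).1, fun V => (hz V).2.1, fun V => (hz V).2.2⟩

end NhdBase

/-! ### Integration of pairs: multiplicativity, non-degeneracy, injectivity. -/

section Integrated

variable {𝕜 G A X : Type*} [RCLike 𝕜]
  [Group G] [TopologicalSpace G] [IsTopologicalGroup G] [LocallyCompactSpace G] [T2Space G]
  [MeasurableSpace G] [BorelSpace G] (μ : Measure G) [μ.IsHaarMeasure] [μ.Regular]
  [NonUnitalNormedRing A] [NormedSpace 𝕜 A] [IsScalarTower 𝕜 A A] [SMulCommClass 𝕜 A A]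
  [CompleteSpace A] [NormedSpace ℝ A] [IsScalarTower ℝ 𝕜 A]
  [NormedAddCommGroup X] [NormedSpace 𝕜 X] [CompleteSpace X]
  [NormedSpace ℝ X] [IsScalarTower ℝ 𝕜 X]
  {α : BddDynSystem 𝕜 G A} {ω : Weight G}

theorem BddDynSystem.apply_inv_apply (α : BddDynSystem 𝕜 G A) (s : G) (a : A) :
    α s (α s⁻¹ a) = a := by
  simpa using α.inv_apply_apply s⁻¹ a

theorem denseRange_toL1 : DenseRange (toL1 μ α ω) :=
  UniformSpace.Completion.denseRange_coe (α := WCc μ α ω)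

theorem tensor_apply (z : C_c(G, ℝ)) (a : A) (r : G) : tensor z a r = z r • a := rfl

theorem transR_apply (z : C_c(G, ℝ)) (s r : G) : transR z s r = z (r * s⁻¹) := rfl

theorem transR_one (z : C_c(G, ℝ)) : transR z 1 = z := by
  ext r
  simp [transR_apply]

theorem check_apply (f : C_c(G, A)) (r : G) : check α f r = modulus r⁻¹ • α r (f r) := rfl

theorem real_smul_clm (S : X →L[𝕜] X) (c : ℝ) (x : X) :
    S (c • x) = c • S x := by
  rw [RCLike.real_smul_eq_coe_smul (K := 𝕜), RCLike.real_smul_eq_coe_smul (K := 𝕜) c (S x),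
    map_smul]

namespace AAPair

/-- After Fubini and `s ↦ r s` the integrand is `U_s U_r π(α_r(g(s))) π(f(r)) x`, which `U_π` turns
into `U_s π(g(s)) U_r π(f(r)) x`; the double integral then splits. -/
theorem integratedCc_conv (P : AAPair α ω X) (f g : C_c(G, A)) (x : X) :
    P.integratedCc μ (toWCc μ α ω (conv μ α f g)) x =
      P.integratedCc μ (toWCc μ α ω g) (P.integratedCc μ (toWCc μ α ω f) x) := by
  have h1 : ∀ s, P.U s (P.π (conv μ α f g s) x) =
      ∫ r, P.U s (P.π (f r * α r (g (r⁻¹ * s))) x) ∂μ := by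
    intro s
    exact (((P.U s).comp ((ContinuousLinearMap.apply 𝕜 X x).comp P.π)).integral_comp_comm
      (conv_integrable μ α f g s)).symm
  have h2 : ∀ r, ∫ s, P.U s (P.π (f r * α r (g (r⁻¹ * s))) x) ∂μ =
      P.integratedCc μ (toWCc μ α ω g) (P.U r (P.π (f r) x)) := by
    intro r
    rw [← integral_mul_left_eq_self _ r, integratedCc_apply]
    congr 1
    ext s
    rw [inv_mul_cancel_left, P.π_mul_apply, P.U_mul_apply, P.U_π]
    rfl
  calc P.integratedCc μ (toWCc μ α ω (conv μ α f g)) x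
      = ∫ s, ∫ r, P.U s (P.π (f r * α r (g (r⁻¹ * s))) x) ∂μ ∂μ := by
        rw [integratedCc_apply]
        exact integral_congr_ae (Eventually.of_forall h1)
    _ = ∫ r, ∫ s, P.U s (P.π (f r * α r (g (r⁻¹ * s))) x) ∂μ ∂μ := by
        refine integral_integral_swap_of_hasCompactSupport ?_ ?_
        · exact P.continuous_uncurry.comp (continuous_fst.prodMk
            ((P.π.continuous.comp (conv_continuous_uncurry α f g)).clm_apply continuous_const))
        · refine hasCompactSupport_uncurry_of_subset
            (f.hasCompactSupport.isCompact.mul g.hasCompactSupport.isCompact)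
            f.hasCompactSupport.isCompact fun s r h => ?_
          obtain ⟨hf, hg⟩ := conv_support α f g s r fun h0 => h (by simp [h0])
          exact ⟨Set.mem_mul.2 ⟨r, subset_tsupport _ hf, r⁻¹ * s, subset_tsupport _ hg, by simp⟩,
            subset_tsupport _ hf⟩
    _ = ∫ r, P.integratedCc μ (toWCc μ α ω g) (P.U r (P.π (f r) x)) ∂μ := by simp only [h2]
    _ = _ := (P.integratedCc μ (toWCc μ α ω g)).integral_comp_comm
        (P.integrable_integrand μ (toWCc μ α ω f) x)

/-- The integrated form of `(π, U)` on `L¹(G, A, ω; α)`. -/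
def integrated (P : AAPair α ω X) : GenBeurling μ α ω →L[𝕜] X →L[𝕜] X :=
  (P.integratedCc μ).extend UniformSpace.Completion.toComplL

theorem integrated_toL1 (P : AAPair α ω X) (f : C_c(G, A)) :
    P.integrated μ (toL1 μ α ω f) = P.integratedCc μ (toWCc μ α ω f) :=
  (P.integratedCc μ).extend_eq UniformSpace.Completion.denseRange_coe
    (UniformSpace.Completion.isUniformInducing_coe _) _

theorem integrated_toL1_apply (P : AAPair α ω X) (f : C_c(G, A)) (x : X) :
    P.integrated μ (toL1 μ α ω f) x = ∫ r, P.U r (P.π (f r) x) ∂μ := by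
  rw [integrated_toL1]
  rfl

theorem norm_integrated_le (P : AAPair α ω X) {C : ℝ} (hC : ∀ r, ‖P.U r‖ ≤ C * ω r) :
    ‖P.integrated μ‖ ≤ C * ‖P.π‖ := by
  have hC0 := P.nonneg_of_norm_le hC
  refine ContinuousLinearMap.opNorm_le_bound _ (by positivity) fun b => ?_
  refine (denseRange_toL1 μ).induction_on b ?_ fun f => ?_
  · exact isClosed_le (by fun_prop) (by fun_prop)
  · rw [integrated_toL1]
    exact (P.norm_integratedCc_le μ hC _).trans_eq
      (by rw [toL1, UniformSpace.Completion.norm_coe])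

theorem integrated_mul (P : AAPair α ω X) (b c : GenBeurling μ α ω) :
    P.integrated μ (b * c) = P.integrated μ c * P.integrated μ b := by
  refine (denseRange_toL1 μ).induction_on₂ ?_ (fun f g => ?_) b c
  · refine isClosed_eq ((P.integrated μ).continuous.comp (GenBeurling.continuous_mul μ α ω)) ?_
    exact ((P.integrated μ).continuous.comp continuous_snd).mul
      ((P.integrated μ).continuous.comp continuous_fst)
  · rw [GenBeurling.toL1_mul, integrated_toL1, integrated_toL1, integrated_toL1]
    ext x
    exact P.integratedCc_conv μ f g x

theorem π_real_smul (P : AAPair α ω X) (c : ℝ) (a : A) (x : X) :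
    P.π (c • a) x = c • P.π a x := by
  rw [RCLike.real_smul_eq_coe_smul (K := 𝕜), RCLike.real_smul_eq_coe_smul (K := 𝕜) c (P.π a x),
    map_smul]
  rfl

/-- The twist `α_r` in `f^∨` lets `U_π` pull the constant `π(b)` out of the integral, and the factor
`Δ(r⁻¹)` absorbs the modulus produced by the substitution `r ↦ r s`. -/
theorem integrated_check_tensor (P : AAPair α ω X) (z : C_c(G, ℝ)) (s : G) (b : A) (x : X) :
    P.integrated μ (toL1 μ α ω (check α (tensor (transR z s) b))) x =
      P.π b (∫ r, (modulus r⁻¹ * z r) • P.U (r * s) x ∂μ) := by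
  have hU : Continuous fun r => P.U (r * s) x := (P.U_cont x).comp (continuous_mul_const s)
  have hi : Integrable (fun r => (modulus r⁻¹ * z r) • P.U (r * s) x) μ := by
    refine Continuous.integrable_of_hasCompactSupport
      (((continuous_modulus.comp continuous_inv).mul z.continuous).smul hU) ?_
    exact z.hasCompactSupport.mono fun r hr h0 => hr (by simp [h0])
  have h1 : ∀ r, P.U r (P.π (check α (tensor (transR z s) b) r) x) =
      (modulus r⁻¹ * z (r * s⁻¹)) • P.π b (P.U r x) := by
    intro r
    rw [check_apply, tensor_apply, transR_apply, P.π_real_smul, real_smul_clm,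
      RCLike.real_smul_eq_coe_smul (K := 𝕜) _ b, map_smul, ← RCLike.real_smul_eq_coe_smul,
      P.π_real_smul, real_smul_clm, P.U_π, smul_smul]
  have h2 := integral_mul_right_eq μ (fun r => (modulus r⁻¹ * z (r * s⁻¹)) • P.π b (P.U r x)) s
  rw [integrated_toL1_apply, ← (P.π b).integral_comp_comm hi]
  simp only [h1]
  have hs := modulus_mul_modulus_inv s
  -- The factor `1 = Δ(s) Δ(s⁻¹)` is inserted so that `Δ(s⁻¹)` can be spent on the right
  -- translation.
  rw [← one_smul ℝ (∫ r, (modulus r⁻¹ * z (r * s⁻¹)) • P.π b (P.U r x) ∂μ), ← hs, mul_smul,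
    ← h2, ← integral_smul]
  congr 1
  ext r
  rw [real_smul_clm, mul_inv_cancel_right, smul_smul, mul_inv_rev, modulus_mul]
  congr 1
  linear_combination modulus r⁻¹ * z r * hs

end AAPair

/-- The normalization of `z_V` is on `r⁻¹`; it makes `Δ(r⁻¹) z_V(r)`, the density in
`integrated_check_tensor`, a probability density. -/
theorem IsBumpFamily.integral_modulus {𝒵 : Set (Set G)} {z : 𝒵 → C_c(G, ℝ)}
    (hz : IsBumpFamily μ 𝒵 z) (V : 𝒵) : ∫ r, modulus r⁻¹ * z V r ∂μ = 1 := by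
  rw [← hz.integral_inv V]
  exact (integral_inv_eq_integral_modulus μ (z V).continuous (z V).hasCompactSupport).symm

theorem IsBumpFamily.tendsto_integral {𝒵 : Set (Set G)} {z : 𝒵 → C_c(G, ℝ)}
    (h : IsCompactNhdBase 𝒵) (hz : IsBumpFamily μ 𝒵 z) {F : G → X} (hF : Continuous F) :
    Tendsto (fun V : (↥𝒵)ᵒᵈ => ∫ r, (modulus r⁻¹ * z (OrderDual.ofDual V) r) • F r ∂μ) atTop
      (𝓝 (F 1)) := by
  rw [Metric.tendsto_nhds]
  intro ε hε
  have hW : {r | ‖F r - F 1‖ < ε / 2} ∈ 𝓝 (1 : G) :=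
    (isOpen_lt (by fun_prop) continuous_const).mem_nhds (by simpa using hε)
  filter_upwards [h.eventually_subset hW] with V hV
  rw [dist_eq_norm]
  refine lt_of_le_of_lt (norm_integral_smul_sub_le
    ((continuous_modulus.comp continuous_inv).mul (z _).continuous)
    (z _).hasCompactSupport.mul_left
    (fun r => mul_nonneg (modulus_pos _).le (hz.nonneg _ r)) (hz.integral_modulus μ _) hF
    (ε := ε / 2) fun r hr => ?_) (half_lt_self hε)
  exact (show ‖F r - F 1‖ < ε / 2 from hV (hz.supp _ (right_ne_zero_of_mul hr))).le

namespace AAPair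

theorem tendsto_integral_U (P : AAPair α ω X) {𝒵 : Set (Set G)} {z : 𝒵 → C_c(G, ℝ)}
    (h : IsCompactNhdBase 𝒵) (hz : IsBumpFamily μ 𝒵 z) (s : G) (x : X) :
    Tendsto (fun V : (↥𝒵)ᵒᵈ =>
      ∫ r, (modulus r⁻¹ * z (OrderDual.ofDual V) r) • P.U (r * s) x ∂μ) atTop (𝓝 (P.U s x)) := by
  simpa using hz.tendsto_integral μ h
    ((P.U_cont x).comp (continuous_mul_const s))

theorem tendsto_check_tensor (P : AAPair α ω X) {𝒵 : Set (Set G)} {z : 𝒵 → C_c(G, ℝ)}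
    (h : IsCompactNhdBase 𝒵) (hz : IsBumpFamily μ 𝒵 z) (s : G) (b : A) (x : X) :
    Tendsto (fun V : (↥𝒵)ᵒᵈ => P.integrated μ (toL1 μ α ω
      (check α (tensor (transR (z (OrderDual.ofDual V)) s) b))) x) atTop
      (𝓝 (P.π b (P.U s x))) := by
  simp only [integrated_check_tensor]
  exact ((P.π b).continuous.tendsto _).comp (P.tendsto_integral_U μ h hz s x)

/-- Since `π` reverses products, `π(u_i) π(a) y = π(a u_i) y → π(a) y`: a right approximate identity
acts from the left on the dense span of the ranges. -/
theorem tendsto_π_approx (P : AAPair α ω X) {I : Type*} [Preorder I] {u : I → A}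
    (hu : IsBddApproxRightId u) (x : X) :
    Tendsto (fun i => P.π (u i) x) atTop (𝓝 x) := by
  obtain ⟨M, hM⟩ := hu.bdd
  refine tendsto_of_dense_span (C := ‖P.π‖ * M) (fun i => ?_) P.π_nondeg
    (R := ContinuousLinearMap.id 𝕜 X) ?_ x
  · exact P.π.le_of_opNorm_le_of_le le_rfl (hM i)
  · rintro _ ⟨a, y, rfl⟩
    have : Tendsto (fun i => P.π (a * u i) y) atTop (𝓝 (P.π a y)) :=
      (((P.π.continuous).clm_apply continuous_const).tendsto a).comp (hu.tendsto a)
    simpa only [P.π_mul_apply, ContinuousLinearMap.id_apply] using this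

/-- The averages depend on `V` alone and the operators `π(b_i)` on `i` alone, so the uniform bound
on `π(b_i)` yields a joint limit over the product net. -/
theorem tendsto_joint (P : AAPair α ω X) {𝒵 : Set (Set G)} {z : 𝒵 → C_c(G, ℝ)}
    (h : IsCompactNhdBase 𝒵) (hz : IsBumpFamily μ 𝒵 z) {I : Type*} [Preorder I] {b : I → A} {M : ℝ}
    (hM : ∀ i, ‖b i‖ ≤ M) (s : G) {x w : X}
    (hw : Tendsto (fun i => P.π (b i) (P.U s x)) atTop (𝓝 w)) :
    Tendsto (fun p : (↥𝒵)ᵒᵈ × I => P.integrated μ (toL1 μ α ω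
      (check α (tensor (transR (z (OrderDual.ofDual p.1)) s) (b p.2)))) x) atTop (𝓝 w) := by
  simp only [integrated_check_tensor]
  rw [← prod_atTop_atTop_eq]
  exact tendsto_apply_of_tendsto (S := fun p : (↥𝒵)ᵒᵈ × I => P.π (b p.2)) (C := ‖P.π‖ * M)
    (fun p => P.π.le_of_opNorm_le_of_le le_rfl (hM p.2))
    ((P.tendsto_integral_U μ h hz s x).comp tendsto_fst) (hw.comp tendsto_snd)

theorem integrated_nondeg (P : AAPair α ω X) : NonDegenerate (P.integrated μ) := by
  obtain ⟨𝒵, h⟩ := exists_isCompactNhdBase G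
  obtain ⟨z, hz⟩ := exists_isBumpFamily μ h
  have := h.neBot
  set S := Submodule.span 𝕜 {y : X | ∃ b x, P.integrated μ b x = y}
  have h1 : Submodule.span 𝕜 {y : X | ∃ b x, P.π b x = y} ≤ S.topologicalClosure := by
    rw [Submodule.span_le]
    rintro _ ⟨a, x, rfl⟩
    have := P.tendsto_check_tensor μ h hz 1 a x
    rw [P.U_one] at this
    exact mem_closure_of_tendsto this
      (Eventually.of_forall fun V => Submodule.subset_span ⟨_, _, rfl⟩)
  have h2 := P.π_nondeg.mono h1
  rw [NonDegenerate, ← dense_closure]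
  exact h2

/-- The anti-representation of `L¹(G, A, ω; α)` integrated from a pair `(π, U)`. -/
def toAntiRep (P : AAPair α ω X) : AntiRep μ α ω X where
  T := P.integrated μ
  T_mul := P.integrated_mul μ
  T_nondeg := P.integrated_nondeg μ

/-- The integrated form determines every `π(b) U_s`. Taking `s = e` recovers `π`; letting `b` run
through `v` recovers `U_s`. -/
theorem toAntiRep_injective {J : Type*} [Preorder J] [IsDirected J (· ≤ ·)] [Nonempty J]
    {v : J → A} (hv : IsBddApproxRightId v) :
    Function.Injective (toAntiRep μ : AAPair α ω X → AntiRep μ α ω X) := by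
  intro P Q hPQ
  replace hPQ : P.integrated μ = Q.integrated μ := congrArg AntiRep.T hPQ
  obtain ⟨𝒵, h⟩ := exists_isCompactNhdBase G
  obtain ⟨z, hz⟩ := exists_isBumpFamily μ h
  have := h.neBot
  have key : ∀ b s x, P.π b (P.U s x) = Q.π b (Q.U s x) := fun b s x =>
    tendsto_nhds_unique (P.tendsto_check_tensor μ h hz s b x)
      (by rw [hPQ]; exact Q.tendsto_check_tensor μ h hz s b x)
  refine ext_apply (fun a x => ?_) fun s x => ?_
  · simpa [P.U_one, Q.U_one] using key a 1 x
  · refine tendsto_nhds_unique (P.tendsto_π_approx hv (P.U s x)) ?_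
    simp only [key]
    exact Q.tendsto_π_approx hv (Q.U s x)

end AAPair

end Integrated

/-! ### Operators on the weighted space commuting with left convolution. -/

section Multipliers

variable {𝕜 G A X : Type*} [RCLike 𝕜]
  [Group G] [TopologicalSpace G] [IsTopologicalGroup G] [LocallyCompactSpace G] [T2Space G]
  [MeasurableSpace G] [BorelSpace G] (μ : Measure G) [μ.IsHaarMeasure] [μ.Regular]
  [NonUnitalNormedRing A] [NormedSpace 𝕜 A] [IsScalarTower 𝕜 A A] [SMulCommClass 𝕜 A A]
  [CompleteSpace A] [NormedSpace ℝ A] [IsScalarTower ℝ 𝕜 A]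
  [NormedAddCommGroup X] [NormedSpace 𝕜 X] [CompleteSpace X]
  [NormedSpace ℝ X] [IsScalarTower ℝ 𝕜 X]
  {α : BddDynSystem 𝕜 G A} {ω : Weight G}

section Norm

variable (ω) in
/-- On functions supported in a fixed compact set the weighted norm is controlled by the supremum
norm. -/
theorem exists_norm_toWCc_le (α : BddDynSystem 𝕜 G A) {K : Set G} (hK : IsCompact K) :
    ∃ c : ℝ, 0 < c ∧ ∀ (f : C_c(G, A)) (ε : ℝ), 0 ≤ ε → (∀ r ∉ K, f r = 0) →
      (∀ r ∈ K, ‖f r‖ ≤ ε) → ‖toWCc μ α ω f‖ ≤ c * ε := by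
  obtain ⟨χ, hχ1, -, hχs, hχ⟩ := exists_continuous_one_zero_of_isCompact hK isClosed_empty
    (Set.disjoint_empty K)
  have hi := integrable_mul_weight μ ω χ χ.continuous hχs
  have h0 : 0 ≤ ∫ r, χ r * ω r ∂μ :=
    integral_nonneg fun r => mul_nonneg (hχ r).1 (ω.nonneg' r)
  -- The integral of a cut-off equal to `1` on `K` already suffices; the `+ 1` makes the constant
  -- positive, so that one can divide by it.
  refine ⟨∫ r, χ r * ω r ∂μ + 1, by positivity, fun f ε hε hf hfε => ?_⟩
  have hbd : ‖toWCc μ α ω f‖ ≤ ε * ∫ r, χ r * ω r ∂μ := by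
    rw [WCc.norm_def, ← integral_const_mul]
    refine integral_mono (toWCc μ α ω f).integrable (hi.const_mul ε) fun r => ?_
    change ‖f r‖ * ω r ≤ ε * (χ r * ω r)
    by_cases hr : r ∈ K
    · rw [hχ1 hr, Pi.one_apply, one_mul]
      exact mul_le_mul_of_nonneg_right (hfε r hr) (ω.nonneg' r)
    · rw [hf r hr, norm_zero, zero_mul]
      exact mul_nonneg hε (mul_nonneg (hχ r).1 (ω.nonneg' r))
  linarith

theorem tendsto_toWCc {I : Type*} {l : Filter I} {F : I → C_c(G, A)} {F₀ : C_c(G, A)} {K : Set G}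
    (hK : IsCompact K) (hF₀ : ∀ r ∉ K, F₀ r = 0) (hF : ∀ᶠ i in l, ∀ r ∉ K, F i r = 0)
    (h : ∀ ε > 0, ∀ᶠ i in l, ∀ r ∈ K, ‖F i r - F₀ r‖ ≤ ε) :
    Tendsto (fun i => toWCc μ α ω (F i)) l (𝓝 (toWCc μ α ω F₀)) := by
  obtain ⟨c, hc, hcK⟩ := exists_norm_toWCc_le μ ω α hK
  rw [Metric.tendsto_nhds]
  intro ε hε
  filter_upwards [hF, h (ε / (2 * c)) (by positivity)] with i hi hi'
  rw [dist_eq_norm]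
  have := hcK (F i - F₀) (ε / (2 * c)) (by positivity)
    (fun r hr => by simp [hi r hr, hF₀ r hr]) (fun r hr => by simpa using hi' r hr)
  have h2 : c * (ε / (2 * c)) = ε / 2 := by field_simp
  rw [h2] at this
  exact this.trans_lt (half_lt_self hε)

theorem eventually_forall_norm_sub_le {Q E : Type*} [TopologicalSpace Q] [NormedAddCommGroup E]
    {F : Q → G → E} (hF : Continuous F.uncurry) {K : Set G} (hK : IsCompact K) (q₀ : Q) {ε : ℝ}
    (hε : 0 < ε) : ∀ᶠ q in 𝓝 q₀, ∀ r ∈ K, ‖F q r - F q₀ r‖ ≤ ε := by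
  refine hK.eventually_forall_of_forall_eventually fun r _ => ?_
  have hc : Continuous fun p : Q × G => ‖F p.1 p.2 - F q₀ p.2‖ :=
    (hF.sub (hF.comp (continuous_const.prodMk continuous_snd))).norm
  have := hc.tendsto (q₀, r)
  simp only [sub_self, norm_zero] at this
  filter_upwards [this.eventually (gt_mem_nhds hε)] with p hp using hp.le

theorem tendsto_toWCc_of_continuous_uncurry {Q : Type*} [TopologicalSpace Q]
    {F : Q → C_c(G, A)} (hF : Continuous fun p : Q × G => F p.1 p.2) {K : Set G}
    (hK : IsCompact K) {q₀ : Q} (h : ∀ᶠ q in 𝓝 q₀, ∀ r ∉ K, F q r = 0) :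
    Tendsto (fun q => toWCc μ α ω (F q)) (𝓝 q₀) (𝓝 (toWCc μ α ω (F q₀))) :=
  tendsto_toWCc μ hK h.self_of_nhds h fun _ hε =>
    eventually_forall_norm_sub_le (F := fun q r => F q r) hF hK q₀ hε

end Norm

section Operators

/-- The function `r ↦ f(r) α_r(a)`. -/
def mulRightA (α : BddDynSystem 𝕜 G A) (a : A) (f : C_c(G, A)) : C_c(G, A) where
  toFun r := f r * α r a
  continuous_toFun := f.continuous.mul (α.strong_cont' a)
  hasCompactSupport' := f.hasCompactSupport.mono fun r hr h0 => hr (by simp [h0])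

/-- The function `r ↦ Δ(s⁻¹) f(r s⁻¹)`. -/
def translateR (s : G) (f : C_c(G, A)) : C_c(G, A) where
  toFun r := modulus s⁻¹ • f (r * s⁻¹)
  continuous_toFun := (f.continuous.comp (continuous_mul_const s⁻¹)).const_smul _
  hasCompactSupport' :=
    (f.hasCompactSupport.comp_homeomorph (Homeomorph.mulRight s⁻¹)).smul_left
      (f := fun _ => modulus s⁻¹)

theorem mulRightA_apply (a : A) (f : C_c(G, A)) (r : G) :
    mulRightA α a f r = f r * α r a := rfl

theorem translateR_apply (s : G) (f : C_c(G, A)) (r : G) :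
    translateR s f r = modulus s⁻¹ • f (r * s⁻¹) := rfl

theorem BddDynSystem.map_real_smul (α : BddDynSystem 𝕜 G A) (s : G) (c : ℝ) (a : A) :
    α s (c • a) = c • α s a := by
  rw [RCLike.real_smul_eq_coe_smul (K := 𝕜), map_smul, ← RCLike.real_smul_eq_coe_smul]

theorem mul_real_smul (𝕜 : Type*) {B : Type*} [RCLike 𝕜] [NonUnitalNormedRing B] [NormedSpace 𝕜 B]
    [SMulCommClass 𝕜 B B] [NormedSpace ℝ B] [IsScalarTower ℝ 𝕜 B] (c : ℝ) (a b : B) :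
    a * (c • b) = c • (a * b) := by
  rw [RCLike.real_smul_eq_coe_smul (K := 𝕜), mul_smul_comm, ← RCLike.real_smul_eq_coe_smul]

/-- Associativity of convolution with `a δ_e` as third factor; it rests on `α_s(a) = α_r(α_{r⁻¹
s}(a))`. -/
theorem mulRightA_conv (a : A) (f g : C_c(G, A)) :
    mulRightA α a (conv μ α f g) = conv μ α f (mulRightA α a g) := by
  ext s
  rw [mulRightA_apply, conv_apply, conv_apply]
  refine (((ContinuousLinearMap.mul 𝕜 A).flip (α s a)).integral_comp_comm
    (conv_integrable μ α f g s)).symm.trans ?_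
  congr 1
  ext r
  rw [mulRightA_apply, α.map_mul', ContinuousLinearMap.flip_apply, ContinuousLinearMap.mul_apply',
    mul_assoc]
  congr 2
  have : (α.toHom r * α.toHom (r⁻¹ * s)) a = α.toHom s a := by rw [← map_mul]; simp
  exact this.symm

theorem translateR_conv (t : G) (f g : C_c(G, A)) :
    translateR t (conv μ α f g) = conv μ α f (translateR t g) := by
  ext s
  rw [translateR_apply, conv_apply, conv_apply, ← integral_smul]
  congr 1
  ext r
  rw [translateR_apply, α.map_real_smul, mul_real_smul 𝕜, mul_assoc]

theorem norm_mulRightA_le {C : ℝ} (hC : ∀ s, ‖α s‖ ≤ C) (a : A) (f : C_c(G, A)) :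
    ‖toWCc μ α ω (mulRightA α a f)‖ ≤ C * ‖a‖ * ‖toWCc μ α ω f‖ := by
  rw [WCc.norm_def, WCc.norm_def, ← integral_const_mul]
  refine integral_mono (toWCc μ α ω _).integrable
    ((toWCc μ α ω f).integrable.const_mul _) fun r => ?_
  change ‖f r * α r a‖ * ω r ≤ C * ‖a‖ * (‖f r‖ * ω r)
  have h1 : ‖f r * α r a‖ ≤ ‖f r‖ * (C * ‖a‖) :=
    (norm_mul_le _ _).trans
      (mul_le_mul_of_nonneg_left ((α r).le_of_opNorm_le (hC r) a) (norm_nonneg _))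
  exact (mul_le_mul_of_nonneg_right h1 (ω.nonneg' r)).trans_eq (by ring)

/-- `ω(r) ≤ ω(r s⁻¹) ω(s)`, and the factor `Δ(s⁻¹)` cancels the modulus of the translation, so the
constant is exactly `ω(s)`. -/
theorem norm_translateR_le (s : G) (f : C_c(G, A)) :
    ‖toWCc μ α ω (translateR s f)‖ ≤ ω s * ‖toWCc μ α ω f‖ := by
  have hi := integrable_mul_right μ (toWCc μ α ω f).integrable s⁻¹
  have h := integral_mul_right_eq μ (fun r => ‖f r‖ * ω r) s⁻¹
  rw [inv_inv] at h
  calc ‖toWCc μ α ω (translateR s f)‖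
      ≤ ∫ r, (ω s * modulus s⁻¹) * (‖f (r * s⁻¹)‖ * ω (r * s⁻¹)) ∂μ := by
        rw [WCc.norm_def]
        refine integral_mono (toWCc μ α ω _).integrable (hi.const_mul _) fun r => ?_
        change ‖modulus s⁻¹ • f (r * s⁻¹)‖ * ω r ≤ _
        rw [norm_smul, Real.norm_of_nonneg (modulus_pos _).le]
        have := ω.submul' (r * s⁻¹) s
        rw [inv_mul_cancel_right] at this
        have hp := (modulus_pos s⁻¹).le
        exact (mul_le_mul_of_nonneg_left this (by positivity)).trans_eq (by ring)
    _ = ω s * ‖toWCc μ α ω f‖ := by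
        rw [integral_const_mul, h, WCc.norm_def, smul_eq_mul]
        change _ = ω s * ∫ r, ‖f r‖ * ω r ∂μ
        linear_combination ω s * (∫ r, ‖f r‖ * ω r ∂μ) * modulus_mul_modulus_inv s

variable (α ω) in
/-- `f ↦ (r ↦ f(r) α_r(a))` as a bounded operator for the weighted norm. -/
def mulRightL (a : A) : WCc μ α ω →L[𝕜] WCc μ α ω :=
  LinearMap.mkContinuousOfExistsBound
    { toFun := fun f => toWCc μ α ω (mulRightA α a f)
      map_add' := fun f g => DFunLike.ext (F := C_c(G, A)) _ _ fun r => add_mul (f r) (g r) _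
      map_smul' := fun c f => DFunLike.ext (F := C_c(G, A)) _ _ fun r =>
        smul_mul_assoc c (f r) _ }
    (by
      obtain ⟨C, hC⟩ := α.bdd'
      exact ⟨C * ‖a‖, fun f => norm_mulRightA_le μ hC a f⟩)

variable (α ω) in
/-- `f ↦ (r ↦ Δ(s⁻¹) f(r s⁻¹))` as a bounded operator for the weighted norm. -/
def translateL (s : G) : WCc μ α ω →L[𝕜] WCc μ α ω :=
  LinearMap.mkContinuousOfExistsBound
    { toFun := fun f => toWCc μ α ω (translateR s f)
      map_add' := fun f g => DFunLike.ext (F := C_c(G, A)) _ _ fun _ => smul_add _ (f _) (g _)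
      map_smul' := fun c f => DFunLike.ext (F := C_c(G, A)) _ _ fun _ =>
        smul_comm (modulus s⁻¹) c (f _) }
    ⟨ω s, fun f => norm_translateR_le μ s f⟩

theorem norm_mulRightL_le {C : ℝ} (hC : ∀ s, ‖α s‖ ≤ C) (a : A) :
    ‖mulRightL μ α ω a‖ ≤ C * ‖a‖ :=
  ContinuousLinearMap.opNorm_le_bound _
    (mul_nonneg ((norm_nonneg _).trans (hC 1)) (norm_nonneg a)) fun f => norm_mulRightA_le μ hC a f

theorem norm_translateL_le (s : G) : ‖translateL μ α ω s‖ ≤ ω s :=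
  ContinuousLinearMap.opNorm_le_bound _ (ω.nonneg' s) fun f => norm_translateR_le μ s f

theorem tendsto_translateR (f : C_c(G, A)) (s₀ : G) :
    Tendsto (fun s => toWCc μ α ω (translateR s f)) (𝓝 s₀)
      (𝓝 (toWCc μ α ω (translateR s₀ f))) := by
  obtain ⟨N, hN, hsN⟩ := exists_compact_mem_nhds s₀
  refine tendsto_toWCc_of_continuous_uncurry μ ?_ (f.hasCompactSupport.isCompact.mul hN) ?_
  · exact ((continuous_modulus.comp continuous_fst.inv)).smul
      (f.continuous.comp (continuous_snd.mul continuous_fst.inv))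
  · filter_upwards [hsN] with s hs r hr
    rw [translateR_apply, image_eq_zero_of_notMem_tsupport (f := f), smul_zero]
    exact fun h => hr (Set.mem_mul.2 ⟨_, h, s, hs, by simp⟩)

end Operators

/-! ### A bounded approximate right identity for twisted convolution. -/

section ApproximateIdentity

/-- The maps `b ↦ b u_i` are equicontinuous because `u` is bounded, so pointwise convergence is
uniform on compact sets. -/
theorem IsBddApproxRightId.eventually_forall {I : Type*} [Preorder I]
    {u : I → A} (hu : IsBddApproxRightId u) {B : Set A} (hB : IsCompact B) {ε : ℝ} (hε : 0 < ε) :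
    ∀ᶠ i in atTop, ∀ b ∈ B, ‖b * u i - b‖ ≤ ε := by
  obtain ⟨M, hM⟩ := hu.bdd
  refine hB.induction_on (p := fun S => ∀ᶠ i in atTop, ∀ b ∈ S, ‖b * u i - b‖ ≤ ε) (by simp)
    (fun S T hST hT => hT.mono fun i hi b hb => hi b (hST hb)) (fun S T hS hT => ?_) fun a _ => ?_
  · filter_upwards [hS, hT] with i hi hi' b hb
    exact hb.elim (hi b) (hi' b)
  · have hδ : 0 < ε / (2 * (|M| + 1)) := by positivity
    refine ⟨_, mem_nhdsWithin_of_mem_nhds (Metric.ball_mem_nhds a hδ), ?_⟩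
    filter_upwards [Metric.tendsto_nhds.1 (hu.tendsto a) (ε / 2) (half_pos hε)] with i hi b hb
    rw [dist_eq_norm] at hi
    have hb' : ‖b - a‖ ≤ ε / (2 * (|M| + 1)) := by
      rw [← dist_eq_norm]; exact (Metric.mem_ball.1 hb).le
    have h1 : ‖(b - a) * u i - (b - a)‖ ≤ ε / 2 := by
      calc ‖(b - a) * u i - (b - a)‖ ≤ ‖b - a‖ * ‖u i‖ + ‖b - a‖ :=
            (norm_sub_le _ _).trans (add_le_add_left (norm_mul_le _ _) _)
        _ = ‖b - a‖ * (‖u i‖ + 1) := by ring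
        _ ≤ ε / (2 * (|M| + 1)) * (|M| + 1) := by
            gcongr
            exact (hM i).trans (le_abs_self M)
        _ = ε / 2 := by field_simp
    have h2 : b * u i - b = ((b - a) * u i - (b - a)) + (a * u i - a) := by
      rw [sub_mul]; abel
    rw [h2]
    exact (norm_add_le _ _).trans (by linarith)

/-- Write `f(r) α_r(u_i) = α_r(α_{r⁻¹}(f(r)) u_i)`: the elements `α_{r⁻¹}(f(r))` with `r ∈ tsupport
f` form a compact set, and the `α_r` are uniformly bounded. -/
theorem IsBddApproxRightId.eventually_mulRightA {I : Type*} [Preorder I]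
    {u : I → A} (hu : IsBddApproxRightId u) (f : C_c(G, A)) {ε : ℝ} (hε : 0 < ε) :
    ∀ᶠ i in atTop, ∀ r, ‖mulRightA α (u i) f r - f r‖ ≤ ε := by
  obtain ⟨C, hC⟩ := α.bdd'
  have hC0 : 0 ≤ C := (norm_nonneg _).trans (hC 1)
  have hB : IsCompact ((fun r => α r⁻¹ (f r)) '' tsupport f) :=
    f.hasCompactSupport.isCompact.image
      (α.continuous_uncurry.comp (continuous_inv.prodMk f.continuous))
  filter_upwards [hu.eventually_forall hB (ε := ε / (C + 1)) (by positivity)] with i hi r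
  by_cases hr : r ∈ tsupport f
  · have h1 : mulRightA α (u i) f r - f r =
        α r (α r⁻¹ (f r) * u i - α r⁻¹ (f r)) := by
      rw [map_sub, α.map_mul', α.apply_inv_apply, mulRightA_apply]
    rw [h1]
    refine ((α r).le_of_opNorm_le_of_le (hC r) (hi _ ⟨r, hr, rfl⟩)).trans ?_
    rw [mul_div_assoc', div_le_iff₀ (by positivity)]
    nlinarith
  · rw [mulRightA_apply, image_eq_zero_of_notMem_tsupport hr]
    simpa using hε.le

/-- Substituting `r = s t` exhibits the convolution as an average with density `z(t⁻¹)`, which is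
where the normalization `∫ z_V(r⁻¹) dr = 1` is natural. -/
theorem conv_tensor_apply (f : C_c(G, A)) (z : C_c(G, ℝ)) (a : A) (s : G) :
    conv μ α f (tensor z a) s = ∫ t, z t⁻¹ • mulRightA α a f (s * t) ∂μ := by
  rw [conv_apply, ← integral_mul_left_eq_self _ s]
  congr 1
  ext t
  rw [tensor_apply, α.map_real_smul, mul_real_smul 𝕜, mulRightA_apply]
  simp

theorem tendsto_conv_tensor {𝒵 : Set (Set G)} {z : 𝒵 → C_c(G, ℝ)} (h : IsCompactNhdBase 𝒵)
    (hz : IsBumpFamily μ 𝒵 z) {I : Type*} [Preorder I] {u : I → A}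
    (hu : IsBddApproxRightId u) (f : C_c(G, A)) :
    Tendsto (fun p : (↥𝒵)ᵒᵈ × I => toWCc μ α ω (conv μ α f (tensor (z (OrderDual.ofDual p.1))
      (u p.2)))) (atTop ×ˢ atTop) (𝓝 (toWCc μ α ω f)) := by
  obtain ⟨L, hL, hzL⟩ := h.compact
  have hf := f.hasCompactSupport.isCompact
  have hK : IsCompact (tsupport f ∪ tsupport f * L) := hf.union (hf.mul hL)
  refine tendsto_toWCc μ hK (fun r hr => ?_) (Eventually.of_forall fun p r hr => ?_)
    fun ε hε => ?_
  · exact image_eq_zero_of_notMem_tsupport fun h => hr (Or.inl h)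
  · rw [conv_tensor_apply]
    refine integral_eq_zero_of_ae (Eventually.of_forall fun t => ?_)
    by_contra h0
    have ht : t⁻¹ ∈ L := hzL _ (Subtype.coe_prop _) (hz.supp _ (left_ne_zero_of_smul h0))
    refine hr (Or.inr (Set.mem_mul.2 ⟨r * t, ?_, t⁻¹, ht, by simp⟩))
    by_contra h1
    refine h0 ?_
    simp [mulRightA_apply, image_eq_zero_of_notMem_tsupport h1]
  -- The inverse is there because the density at `t` is `z_V(t⁻¹)`, so it is `t⁻¹` that lies in `V`.
  · have hW := eventually_forall_norm_sub_le (F := fun t s => f (s * t⁻¹))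
      (f.continuous.comp (continuous_snd.mul continuous_fst.inv)) hK 1 (half_pos hε)
    filter_upwards [(h.eventually_subset hW).prod_mk
      (hu.eventually_mulRightA (α := α) f (half_pos hε))] with p hp s hs
    rw [conv_tensor_apply]
    refine norm_integral_smul_sub_le ((z _).continuous.comp continuous_inv)
      ((z _).hasCompactSupport.comp_homeomorph (Homeomorph.inv G)) (fun r => hz.nonneg _ _)
      (hz.integral_inv _) ((mulRightA α (u p.2) f).continuous.comp (continuous_const_mul s))
      fun t ht => ?_
    have h1 := hp.1 (hz.supp _ ht) s hs
    have h2 := hp.2 (s * t)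
    simp only [inv_inv, inv_one, mul_one] at h1
    change ‖mulRightA α (u p.2) f (s * t) - f s‖ ≤ ε
    calc _ = ‖(mulRightA α (u p.2) f (s * t) - f (s * t)) + (f (s * t) - f s)‖ := by
          rw [sub_add_sub_cancel]
      _ ≤ ε := (norm_add_le _ _).trans (by linarith)

/-- All supports lie in one compact set, on which `ω` and `Δ` are bounded; writing `z_V(r) = Δ(r) ·
Δ(r⁻¹) z_V(r)` leaves a probability density. -/
theorem exists_norm_tensor_le {𝒵 : Set (Set G)} {z : 𝒵 → C_c(G, ℝ)} (h : IsCompactNhdBase 𝒵)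
    (hz : IsBumpFamily μ 𝒵 z) :
    ∃ c : ℝ, 0 ≤ c ∧ ∀ V (a : A), ‖toWCc μ α ω (tensor (z V) a)‖ ≤ c * ‖a‖ := by
  obtain ⟨L, hL, hzL⟩ := h.compact
  obtain ⟨D, hD⟩ := ω.bddOn_compact hL
  obtain ⟨D', hD'⟩ := hL.exists_bound_of_continuousOn (continuous_modulus (G := G)).continuousOn
  have hi : ∀ V, Integrable (fun r => modulus r⁻¹ * z V r) μ := fun V =>
    ((continuous_modulus.comp continuous_inv).mul (z V).continuous).integrable_of_hasCompactSupport
      (z V).hasCompactSupport.mul_left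
  refine ⟨|D * D'|, abs_nonneg _, fun V a => ?_⟩
  calc ‖toWCc μ α ω (tensor (z V) a)‖ ≤ ∫ r, (|D * D'| * ‖a‖) * (modulus r⁻¹ * z V r) ∂μ := by
        rw [WCc.norm_def]
        refine integral_mono (toWCc μ α ω _).integrable ((hi V).const_mul _) fun r => ?_
        change ‖z V r • a‖ * ω r ≤ (|D * D'| * ‖a‖) * (modulus r⁻¹ * z V r)
        rw [norm_smul, Real.norm_of_nonneg (hz.nonneg V r)]
        by_cases hr : z V r = 0
        · simp [hr]
        have hrL : r ∈ L := hzL _ V.2 (hz.supp V hr)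
        have h1 : ω r * modulus r ≤ |D * D'| :=
          (mul_le_mul (hD r hrL) ((le_abs_self _).trans (hD' r hrL)) (modulus_pos r).le
            ((ω.nonneg' r).trans (hD r hrL))).trans (le_abs_self _)
        have hz0 := hz.nonneg V r
        have hm := (modulus_pos r⁻¹).le
        calc z V r * ‖a‖ * ω r = (ω r * modulus r) * (‖a‖ * (modulus r⁻¹ * z V r)) := by
              linear_combination -(z V r * ‖a‖ * ω r) * modulus_mul_modulus_inv r
          _ ≤ |D * D'| * (‖a‖ * (modulus r⁻¹ * z V r)) :=
              mul_le_mul_of_nonneg_right h1 (by positivity)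
          _ = _ := by ring
    _ = _ := by rw [integral_const_mul, hz.integral_modulus μ V, mul_one]

end ApproximateIdentity

end Multipliers

/-- `S` is the strong limit of `τ(R e_i)`: on `τ(f) x` this is `τ(m f (R e_i)) x = τ(R (m f e_i)) x
→ τ(R f) x`. -/
theorem exists_multiplier_operator {𝕜 E X I : Type*} [RCLike 𝕜] [SeminormedAddCommGroup E]
    [NormedSpace 𝕜 E] [NormedAddCommGroup X] [NormedSpace 𝕜 X] [CompleteSpace X] {l : Filter I}
    [l.NeBot] (τ : E →L[𝕜] X →L[𝕜] X) (m : E → E → E) (hm : ∀ f g x, τ (m f g) x = τ g (τ f x))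
    (hτ : Dense (Submodule.span 𝕜 {y : X | ∃ f x, τ f x = y} : Set X)) {e : I → E} {M : ℝ}
    (he : ∀ i, ‖e i‖ ≤ M) (hme : ∀ f, Tendsto (fun i => m f (e i)) l (𝓝 f)) (R : E →L[𝕜] E)
    (hR : ∀ f g, R (m f g) = m f (R g)) :
    ∃ S : X →L[𝕜] X, (∀ f x, S (τ f x) = τ (R f) x) ∧ ‖S‖ ≤ ‖τ‖ * (‖R‖ * M) := by
  have key : ∀ f x, Tendsto (fun i => τ (R (e i)) (τ f x)) l (𝓝 (τ (R f) x)) := by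
    intro f x
    simp only [← hm, ← hR]
    exact (((τ.continuous.comp R.continuous).clm_apply continuous_const).tendsto f).comp (hme f)
  obtain ⟨S, hS, hS'⟩ := exists_strong_limit (S := fun i => τ (R (e i)))
    (fun i => τ.le_of_opNorm_le_of_le le_rfl (R.le_of_opNorm_le_of_le le_rfl (he i))) hτ
    (by rintro _ ⟨f, x, rfl⟩; exact ⟨_, key f x⟩)
  exact ⟨S, fun f x => tendsto_nhds_unique (hS _) (key f x), hS'⟩

/-! ### Every non-degenerate anti-representation comes from a pair. -/

section Disintegration
variable {𝕜 G A X : Type*} [RCLike 𝕜]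
  [Group G] [TopologicalSpace G] [IsTopologicalGroup G] [LocallyCompactSpace G] [T2Space G]
  [MeasurableSpace G] [BorelSpace G] (μ : Measure G) [μ.IsHaarMeasure] [μ.Regular]
  [NonUnitalNormedRing A] [NormedSpace 𝕜 A] [IsScalarTower 𝕜 A A] [SMulCommClass 𝕜 A A]
  [CompleteSpace A] [NormedSpace ℝ A] [IsScalarTower ℝ 𝕜 A]
  [NormedAddCommGroup X] [NormedSpace 𝕜 X] [CompleteSpace X]
  [NormedSpace ℝ X] [IsScalarTower ℝ 𝕜 X]
  {α : BddDynSystem 𝕜 G A} {ω : Weight G}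

/-- If `k(t) = ∫ H_r(t) dr` for a jointly continuous compactly supported family `H`, then bounded
operators on the weighted space commute with this integral. -/
theorem integral_apply_toWCc {H : G → C_c(G, A)} (hH : Continuous fun p : G × G => H p.1 p.2)
    {K L : Set G} (hK : IsCompact K) (hL : IsCompact L)
    (hHK : ∀ r t, H r t ≠ 0 → r ∈ K ∧ t ∈ L) {k : C_c(G, A)} (hk : ∀ t, k t = ∫ r, H r t ∂μ)
    (Ψ : WCc μ α ω →L[𝕜] X) :
    ∫ r, Ψ (toWCc μ α ω (H r)) ∂μ = Ψ (toWCc μ α ω k) := by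
  obtain ⟨χ, hχ1, -, hχs, hχ⟩ := exists_continuous_one_zero_of_isCompact hL isClosed_empty
    (Set.disjoint_empty L)
  -- The weighted space need not be complete, so the integral of `H` is formed in the Banach space
  -- of bounded continuous functions and transported by multiplication with the cut-off `χ`.
  let Φ : BoundedContinuousFunction G A →L[𝕜] WCc μ α ω :=
    LinearMap.mkContinuousOfExistsBound
      { toFun := fun h => toWCc μ α ω
          ⟨⟨fun t => χ t • h t, χ.continuous.smul h.continuous⟩, hχs.smul_right⟩
        map_add' := fun f g => DFunLike.ext (F := C_c(G, A)) _ _ fun t => smul_add _ (f t) (g t)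
        map_smul' := fun c f => DFunLike.ext (F := C_c(G, A)) _ _ fun t =>
          smul_comm (χ t) c (f t) }
      (by
        obtain ⟨c, hc, hcK⟩ := exists_norm_toWCc_le μ ω α hχs.isCompact
        refine ⟨c, fun h => hcK _ _ (norm_nonneg h) (fun t ht => ?_) fun t _ => ?_⟩
        · change χ t • h t = 0
          rw [image_eq_zero_of_notMem_tsupport ht, zero_smul]
        · change ‖χ t • h t‖ ≤ _
          rw [norm_smul, Real.norm_of_nonneg (hχ t).1]
          exact (mul_le_mul (hχ t).2 (h.norm_coe_le_norm t) (norm_nonneg _) zero_le_one).trans_eq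
            (one_mul _))
  have hbd : ∀ r, ∃ C, ∀ t, ‖H r t‖ ≤ C := fun r =>
    (H r).hasCompactSupport.exists_bound_of_continuous (H r).continuous
  choose C hC using hbd
  let Hb : G → BoundedContinuousFunction G A := fun r =>
    BoundedContinuousFunction.ofNormedAddCommGroup (H r) (H r).continuous (C r) (hC r)
  have hL0 : ∀ r, ∀ t ∉ L, H r t = 0 := fun r t ht => by
    by_contra h0; exact ht (hHK r t h0).2
  have hΦ : ∀ (h : BoundedContinuousFunction G A) (f : C_c(G, A)), (∀ t, h t = f t) →
      (∀ t ∉ L, f t = 0) → Φ h = toWCc μ α ω f := by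
    intro h f hf hfL
    refine DFunLike.ext (F := C_c(G, A)) _ _ fun t => ?_
    change χ t • h t = f t
    by_cases ht : t ∈ L
    · rw [hχ1 ht, Pi.one_apply, one_smul, hf]
    · rw [hf, hfL t ht, smul_zero]
  have hHb : Continuous Hb := by
    refine continuous_iff_continuousAt.2 fun r₀ => Metric.tendsto_nhds.2 fun ε hε => ?_
    filter_upwards [eventually_forall_norm_sub_le (F := fun r t => H r t) hH hL r₀ (half_pos hε)]
      with r hr
    refine ((BoundedContinuousFunction.dist_le (half_pos hε).le).2 fun t => ?_).trans_lt
      (half_lt_self hε)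
    rw [dist_eq_norm]
    change ‖H r t - H r₀ t‖ ≤ _
    by_cases ht : t ∈ L
    · exact hr t ht
    · rw [hL0 r t ht, hL0 r₀ t ht]
      simpa using (half_pos hε).le
  have hi : Integrable Hb μ := by
    refine hHb.integrable_of_hasCompactSupport (HasCompactSupport.intro hK fun r hr => ?_)
    ext t
    change H r t = 0
    by_contra h0
    exact hr (hHK r t h0).1
  calc ∫ r, Ψ (toWCc μ α ω (H r)) ∂μ = ∫ r, (Ψ.comp Φ) (Hb r) ∂μ := by
        congr 1
        ext r
        rw [ContinuousLinearMap.comp_apply, hΦ (Hb r) (H r) (fun t => rfl) (hL0 r)]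
    _ = Ψ (Φ (∫ r, Hb r ∂μ)) := (Ψ.comp Φ).integral_comp_comm hi
    _ = Ψ (toWCc μ α ω k) := by
        rw [hΦ _ k (fun t => ?_) fun t ht => ?_]
        · rw [hk]
          exact ((BoundedContinuousFunction.evalCLM ℝ t).integral_comp_comm hi).symm
        · rw [hk]
          simp [hL0 _ t ht]

/-- Right convolution by `f` is the superposition of the multipliers `a δ_e` with `a = f(r)`,
followed by `δ_r`. The proof substitutes `r ↦ t⁻¹ r` and then inverts, which produces the factor
`Δ(r⁻¹)`. -/
theorem conv_eq_integral_translateR (f g : C_c(G, A)) (t : G) :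
    conv μ α g f t = ∫ r, translateR r (mulRightA α (f r) g) t ∂μ := by
  have hF : Continuous fun r => mulRightA α (f r) g (t * r⁻¹) :=
    (g.continuous.comp (continuous_const.mul continuous_inv)).mul
      (α.continuous_uncurry.comp ((continuous_const.mul continuous_inv).prodMk f.continuous))
  have hFs : HasCompactSupport fun r => mulRightA α (f r) g (t * r⁻¹) :=
    f.hasCompactSupport.mono fun r hr h0 => hr (by simp [mulRightA_apply, h0])
  have h := integral_inv_eq_integral_modulus μ hF hFs
  rw [← integral_mul_left_eq_self _ t⁻¹] at h
  rw [conv_apply]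
  simp only [mul_inv_rev, inv_inv, mul_inv_cancel_left, mulRightA_apply] at h
  exact h

namespace AntiRep

/-- The restriction of `T` to `C_c(G, A)`. -/
def onCc (T : AntiRep μ α ω X) : WCc μ α ω →L[𝕜] X →L[𝕜] X :=
  T.T.comp UniformSpace.Completion.toComplL

theorem onCc_apply (T : AntiRep μ α ω X) (f : C_c(G, A)) :
    T.onCc μ (toWCc μ α ω f) = T.T (toL1 μ α ω f) := rfl

theorem onCc_conv (T : AntiRep μ α ω X) (f g : C_c(G, A)) (x : X) :
    T.onCc μ (toWCc μ α ω (conv μ α f g)) x =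
      T.onCc μ (toWCc μ α ω g) (T.onCc μ (toWCc μ α ω f) x) := by
  rw [onCc_apply, ← GenBeurling.toL1_mul, T.T_mul]
  rfl

theorem ext_onCc {T T' : AntiRep μ α ω X}
    (h : ∀ f x, T.onCc μ (toWCc μ α ω f) x = T'.onCc μ (toWCc μ α ω f) x) : T = T' := by
  have h1 : T.T = T'.T := by
    refine ContinuousLinearMap.ext fun b => ?_
    refine (denseRange_toL1 μ).induction_on b (isClosed_eq T.T.continuous T'.T.continuous)
      fun f => ?_
    exact ContinuousLinearMap.ext (h f)
  cases T; cases T'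
  simp only at h1
  subst h1
  rfl

theorem onCc_nondeg (T : AntiRep μ α ω X) : NonDegenerate (T.onCc μ) := by
  set S := Submodule.span 𝕜 {y : X | ∃ f x, T.onCc μ f x = y}
  have h1 : Submodule.span 𝕜 {y : X | ∃ b x, T.T b x = y} ≤ S.topologicalClosure := by
    rw [Submodule.span_le]
    rintro _ ⟨b, x, rfl⟩
    refine (denseRange_toL1 μ).induction_on (p := fun b => T.T b x ∈ S.topologicalClosure) b
      (S.isClosed_topologicalClosure.preimage (T.T.continuous.clm_apply continuous_const))
      fun f => ?_
    exact subset_closure (Submodule.subset_span ⟨toWCc μ α ω f, x, rfl⟩)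
  rw [NonDegenerate, ← dense_closure]
  exact T.T_nondeg.mono h1

/-- `M` does not depend on `R`; this gives boundedness of `a ↦ π(a)` and `‖U_s‖ ≤ M ω(s)` with
uniform constants. -/
theorem exists_operator (T : AntiRep μ α ω X) {J : Type*} [Preorder J] [IsDirected J (· ≤ ·)]
    [Nonempty J] {v : J → A} (hv : IsBddApproxRightId v) :
    ∃ M : ℝ, 0 ≤ M ∧ ∀ R : WCc μ α ω →L[𝕜] WCc μ α ω,
      (∀ f g, R (convL μ α ω f g) = convL μ α ω f (R g)) →
      ∃ S : X →L[𝕜] X, (∀ f x, S (T.onCc μ f x) = T.onCc μ (R f) x) ∧ ‖S‖ ≤ M * ‖R‖ := by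
  obtain ⟨𝒵, h⟩ := exists_isCompactNhdBase G
  obtain ⟨z, hz⟩ := exists_isBumpFamily μ h
  have := h.neBot
  obtain ⟨c, hc, hcz⟩ := exists_norm_tensor_le μ (A := A) (α := α) (ω := ω) h hz
  obtain ⟨M, hM⟩ := hv.bdd
  have hM0 : 0 ≤ M := (norm_nonneg _).trans (hM (Classical.arbitrary J))
  refine ⟨‖T.onCc μ‖ * (c * M), by positivity, fun R hR => ?_⟩
  obtain ⟨S, hS, hS'⟩ := exists_multiplier_operator (l := atTop ×ˢ atTop) (T.onCc μ)
    (fun f g => convL μ α ω f g) (fun f g x => T.onCc_conv μ f g x) (T.onCc_nondeg μ)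
    (e := fun p : (↥𝒵)ᵒᵈ × J => toWCc μ α ω (tensor (z (OrderDual.ofDual p.1)) (v p.2)))
    (M := c * M) (fun p => (hcz _ _).trans (mul_le_mul_of_nonneg_left (hM _) hc))
    (fun f => tendsto_conv_tensor μ h hz hv f) R hR
  exact ⟨S, hS, hS'.trans_eq (by ring)⟩

/-- Every non-degenerate bounded anti-representation is the integrated form of a pair. -/
theorem exists_pair (T : AntiRep μ α ω X) {J : Type*} [Preorder J] [IsDirected J (· ≤ ·)]
    [Nonempty J] {v : J → A} (hv : IsBddApproxRightId v) :
    ∃ P : AAPair α ω X, P.toAntiRep μ = T := by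
  obtain ⟨M, hM0, hM⟩ := T.exists_operator μ hv
  obtain ⟨C, hC⟩ := α.bdd'
  choose p hp hpn using fun a => hM (mulRightL μ α ω a) fun f g =>
    congrArg (toWCc μ α ω) (mulRightA_conv μ a f g)
  choose U hU hUn using fun s => hM (translateL μ α ω s) fun f g =>
    congrArg (toWCc μ α ω) (translateR_conv μ s f g)
  -- Operators agreeing on all `T(f) x` coincide, so each relation below reduces to a pointwise
  -- identity of functions on `G`.
  have ext : ∀ {R R' : X →L[𝕜] X},
      (∀ f x, R (T.onCc μ (toWCc μ α ω f) x) = R' (T.onCc μ (toWCc μ α ω f) x)) → R = R' :=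
    fun h => eq_of_dense_span (T.onCc_nondeg μ) (by rintro _ ⟨f, x, rfl⟩; exact h f x)
  replace hp : ∀ a f x, p a (T.onCc μ (toWCc μ α ω f) x) =
    T.onCc μ (toWCc μ α ω (mulRightA α a f)) x := fun a f x => hp a _ x
  replace hU : ∀ s f x, U s (T.onCc μ (toWCc μ α ω f) x) =
    T.onCc μ (toWCc μ α ω (translateR s f)) x := fun s f x => hU s _ x
  let π : A →L[𝕜] X →L[𝕜] X := LinearMap.mkContinuous
    { toFun := p
      map_add' := fun a b => ext fun f x => by
        rw [add_apply, hp, hp, hp, ← add_apply, ← map_add]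
        congr 2
        refine DFunLike.ext (F := C_c(G, A)) _ _ fun r => ?_
        change f r * α r (a + b) = f r * α r a + f r * α r b
        rw [map_add, mul_add]
      map_smul' := fun c a => ext fun f x => by
        rw [smul_apply, hp, RingHom.id_apply, hp,
          ← smul_apply, ← map_smul]
        congr 2
        refine DFunLike.ext (F := C_c(G, A)) _ _ fun r => ?_
        change f r * α r (c • a) = c • (f r * α r a)
        rw [map_smul, mul_smul_comm] } (M * C)
    (fun a => by
      refine (hpn a).trans ?_
      rw [mul_assoc]
      exact mul_le_mul_of_nonneg_left (norm_mulRightL_le μ hC a) hM0)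
  have hUω : ∀ s, ‖U s‖ ≤ M * ω s := fun s =>
    (hUn s).trans (mul_le_mul_of_nonneg_left (norm_translateL_le μ s) hM0)
  have hUmul : ∀ r s, U (r * s) = U s * U r := fun r s => ext fun f x => by
    rw [ContinuousLinearMap.mul_def, ContinuousLinearMap.comp_apply, hU, hU, hU]
    congr 3
    ext t
    rw [translateR_apply, translateR_apply, translateR_apply, mul_inv_rev, modulus_mul, smul_smul,
      mul_assoc]
  let P : AAPair α ω X :=
    { π := π
      U := U
      π_mul := fun a b => ext fun f x => by
        change p (a * b) _ = p b (p a _)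
        rw [hp, hp, hp]
        congr 3
        ext r
        rw [mulRightA_apply, mulRightA_apply, mulRightA_apply, α.map_mul', mul_assoc]
      π_nondeg := by
        set S := Submodule.span 𝕜 {y : X | ∃ a x, π a x = y}
        have h1 : Submodule.span 𝕜 {y : X | ∃ f x, T.onCc μ f x = y} ≤ S.topologicalClosure := by
          rw [Submodule.span_le]
          rintro _ ⟨f, x, rfl⟩
          have h2 : Tendsto (fun i => toWCc μ α ω (mulRightA α (v i) f)) atTop (𝓝 f) := by
            refine tendsto_toWCc μ (K := tsupport f) f.hasCompactSupport.isCompact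
              (F₀ := f) (fun r hr => image_eq_zero_of_notMem_tsupport hr)
              (Eventually.of_forall fun i r hr => ?_) fun ε hε =>
              (hv.eventually_mulRightA f hε).mono fun i hi r _ => hi r
            change f r * _ = 0
            rw [image_eq_zero_of_notMem_tsupport hr, zero_mul]
          refine mem_closure_of_tendsto
            ((((T.onCc μ).continuous.clm_apply continuous_const).tendsto f).comp h2)
            (Eventually.of_forall fun i => ?_)
          exact Submodule.subset_span ⟨v i, T.onCc μ f x, hp (v i) f x⟩
        rw [NonDegenerate, ← dense_closure]
        exact (T.onCc_nondeg μ).mono h1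
      U_one := ext fun f x => by
        rw [hU]
        change _ = T.onCc μ (toWCc μ α ω f) x
        congr 3
        ext t
        simp [translateR_apply, modulus_one]
      U_mul := hUmul
      U_cont := fun x => by
        rw [continuous_iff_continuousAt]
        intro s₀
        obtain ⟨N, hN, hsN⟩ := exists_compact_mem_nhds s₀
        obtain ⟨D, hD⟩ := ω.bddOn_compact hN
        -- On the compact set `N` the operators `U s` are uniformly bounded, so continuity need only
        -- be checked on vectors `T(f) y`.
        have hc : ContinuousOn (fun s => U s x) N := by
          rw [continuousOn_iff_continuous_domRestrict, continuous_iff_continuousAt]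
          intro s₁
          refine tendsto_of_dense_span (S := fun s : N => U s) (C := M * D)
            (fun s => (hUω s).trans (mul_le_mul_of_nonneg_left (hD s s.2) hM0))
            (T.onCc_nondeg μ) ?_ x
          rintro _ ⟨f, y, rfl⟩
          have h3 := (tendsto_translateR μ (α := α) (ω := ω) f s₁.1).comp
            (continuous_subtype_val.tendsto s₁)
          have h4 := (((T.onCc μ).continuous.clm_apply
            (continuous_const (y := y))).tendsto _).comp h3
          have h5 := hU s₁ f y
          refine (h4.congr fun s : N => (hU s f y).symm).trans ?_
          rw [← h5]
          exact le_rfl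
        exact hc.continuousAt hsN
      covariant := fun r a => ext fun f x => by
        change U r (p a (U r⁻¹ _)) = p _ _
        rw [hU, hp, hU, hp]
        congr 3
        ext t
        rw [translateR_apply, mulRightA_apply, translateR_apply, mulRightA_apply]
        rw [RCLike.real_smul_eq_coe_smul (K := 𝕜) _ (f _), smul_mul_assoc,
          ← RCLike.real_smul_eq_coe_smul, smul_smul, modulus_mul_modulus_inv, one_smul, inv_inv,
          inv_mul_cancel_right]
        congr 1
        change α.toHom (t * r⁻¹) a = (α.toHom t * α.toHom r⁻¹) a
        rw [map_mul]
      U_bdd := ⟨M, hUω⟩ }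
  refine ⟨P, ext_onCc μ fun f x => ?_⟩
  suffices h : P.integratedCc μ (toWCc μ α ω f) = T.onCc μ (toWCc μ α ω f) by
    rw [← h, onCc_apply]
    exact DFunLike.congr_fun (P.integrated_toL1 μ f) x
  -- On `T(g) y` the integrand is `T` of the translated multiple of `g`, so the integral is `T(g *
  -- f) y = T(f) T(g) y`.
  refine ext fun g y => ?_
  have hH : Continuous fun q : G × G => translateR q.1 (mulRightA α (f q.1) g) q.2 :=
    (continuous_modulus.comp continuous_fst.inv).smul
      ((g.continuous.comp (continuous_snd.mul continuous_fst.inv)).mul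
        (α.continuous_uncurry.comp ((continuous_snd.mul continuous_fst.inv).prodMk
          (f.continuous.comp continuous_fst))))
  have key := integral_apply_toWCc μ (α := α) (ω := ω)
    (H := fun r => translateR r (mulRightA α (f r) g)) hH f.hasCompactSupport.isCompact
    (g.hasCompactSupport.isCompact.mul f.hasCompactSupport.isCompact)
    (fun r t h0 => ?_) (conv_eq_integral_translateR μ f g)
    ((ContinuousLinearMap.apply 𝕜 X y).comp (T.onCc μ))
  · refine Eq.trans ?_ (key.trans (T.onCc_conv μ g f y))
    rw [AAPair.integratedCc_apply]
    congr 1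
    ext r
    change U r (p (f r) _) = T.onCc μ _ y
    rw [hp, hU]
  · rw [translateR_apply, mulRightA_apply] at h0
    have h1 : r ∈ tsupport f := subset_tsupport _ fun h => h0 (by simp [h])
    have h2 : t * r⁻¹ ∈ tsupport g := subset_tsupport _ fun h => h0 (by simp [h])
    exact ⟨h1, Set.mem_mul.2 ⟨_, h2, r, h1, by simp⟩⟩

end AntiRep

end Disintegration

/-! ### Norm bounds for the recovered pair. -/

section Bounds

variable {𝕜 G A X : Type*} [RCLike 𝕜]
  [Group G] [TopologicalSpace G] [IsTopologicalGroup G] [LocallyCompactSpace G] [T2Space G]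
  [MeasurableSpace G] [BorelSpace G] (μ : Measure G) [μ.IsHaarMeasure] [μ.Regular]
  [NonUnitalNormedRing A] [NormedSpace 𝕜 A] [IsScalarTower 𝕜 A A] [SMulCommClass 𝕜 A A]
  [CompleteSpace A] [NormedSpace ℝ A] [IsScalarTower ℝ 𝕜 A]
  [NormedAddCommGroup X] [NormedSpace 𝕜 X] [CompleteSpace X]
  [NormedSpace ℝ X] [IsScalarTower ℝ 𝕜 X]
  {α : BddDynSystem 𝕜 G A} {ω : Weight G}

theorem norm_check_tensor_le {z : C_c(G, ℝ)} (hz0 : ∀ r, 0 ≤ z r)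
    (hz1 : ∫ r, modulus r⁻¹ * z r ∂μ = 1) (s : G) (b : A) {w N : ℝ}
    (hw : ∀ r, z r ≠ 0 → ω (r * s) ≤ w) (hN : ∀ r, z r ≠ 0 → ‖α (r * s) b‖ ≤ N) :
    ‖toWCc μ α ω (check α (tensor (transR z s) b))‖ ≤ w * N := by
  have hi : Integrable (fun r => modulus r⁻¹ * transR z s r) μ :=
    ((continuous_modulus.comp continuous_inv).mul
      (transR z s).continuous).integrable_of_hasCompactSupport
      (transR z s).hasCompactSupport.mul_left
  have h1 : ∫ r, modulus r⁻¹ * transR z s r ∂μ = 1 := by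
    have h := integral_mul_right_eq μ (fun r => modulus r⁻¹ * transR z s r) s
    simp only [transR_apply, mul_inv_rev, modulus_mul, mul_assoc, mul_inv_cancel, mul_one] at h
    rw [integral_const_mul, hz1, smul_eq_mul] at h
    exact (mul_left_cancel₀ (modulus_pos s⁻¹).ne' h).symm
  calc ‖toWCc μ α ω (check α (tensor (transR z s) b))‖
      ≤ ∫ r, (w * N) * (modulus r⁻¹ * transR z s r) ∂μ := by
        rw [WCc.norm_def]
        refine integral_mono (toWCc μ α ω _).integrable (hi.const_mul _) fun r => ?_
        change ‖modulus r⁻¹ • α r (z (r * s⁻¹) • b)‖ * ω r ≤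
          (w * N) * (modulus r⁻¹ * z (r * s⁻¹))
        have hm := (modulus_pos r⁻¹).le
        rw [α.map_real_smul, norm_smul, norm_smul, Real.norm_of_nonneg hm,
          Real.norm_of_nonneg (hz0 _)]
        by_cases hr : z (r * s⁻¹) = 0
        · simp [hr]
        have h2 : ω r ≤ w := by simpa using hw _ hr
        have h3 : ‖α r b‖ ≤ N := by simpa using hN _ hr
        have h4 : ‖α r b‖ * ω r ≤ N * w :=
          mul_le_mul h3 h2 (ω.nonneg' r) ((norm_nonneg _).trans h3)
        calc _ = (modulus r⁻¹ * z (r * s⁻¹)) * (‖α r b‖ * ω r) := by ring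
          _ ≤ (modulus r⁻¹ * z (r * s⁻¹)) * (N * w) :=
              mul_le_mul_of_nonneg_left h4 (mul_nonneg hm (hz0 _))
          _ = _ := by ring
    _ = _ := by rw [integral_const_mul, h1, mul_one]

theorem iInf_iSup_weight_nonneg (ω : Weight G) (𝒵 : Set (Set G)) :
    0 ≤ ⨅ V : 𝒵, ⨆ r : V.1, ω r :=
  Real.iInf_nonneg fun _ => Real.iSup_nonneg fun _ => ω.nonneg' _

namespace AAPair

/-- `π(b) U_s x` is a limit of values of `T` on functions whose norm is controlled by `ω` and `α(·)
b` near `s`. Keeping `c` free allows `c = 1` at `s = e`, where `ω(e)` could exceed `1`. -/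
theorem norm_π_U_le (P : AAPair α ω X) {𝒵 : Set (Set G)} (h : IsCompactNhdBase 𝒵) (s : G) {c : ℝ}
    (hc0 : 0 ≤ c) (hc : ∀ r, ω (r * s) ≤ ω r * c) (b : A) (x : X) : ‖P.π b (P.U s x)‖ ≤
      (⨅ V : 𝒵, ⨆ r : V.1, ω r) * (‖P.integrated μ‖ * c * ‖α s b‖ * ‖x‖) := by
  obtain ⟨z, hz⟩ := exists_isBumpFamily μ h
  have := h.neBot
  obtain ⟨V₀⟩ := h.nonempty
  have : Nonempty 𝒵 := ⟨OrderDual.ofDual V₀⟩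
  obtain ⟨L, hL, hzL⟩ := h.compact
  obtain ⟨D, hD⟩ := ω.bddOn_compact hL
  rw [Real.iInf_mul_of_nonneg (by positivity)]
  refine le_ciInf fun V => ?_
  have hb : BddAbove (Set.range fun r : V.1 => ω r) :=
    ⟨D, by rintro _ ⟨r, rfl⟩; exact hD r (hzL _ V.2 r.2)⟩
  have hw0 : 0 ≤ ⨆ r : V.1, ω r := Real.iSup_nonneg fun _ => ω.nonneg' _
  set w := ⨆ r : V.1, ω r
  -- By continuity `‖α_{rs}(b)‖ < N` for `r` near `e`, so no uniform bound on `α` enters; `N`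
  -- decreases to `‖α_s(b)‖` at the end.
  have key : ∀ N > ‖α s b‖, ‖P.π b (P.U s x)‖ ≤ w * (‖P.integrated μ‖ * c * N * ‖x‖) := by
    intro N hN
    have hW : {r : G | ‖α (r * s) b‖ < N} ∈ 𝓝 (1 : G) :=
      (isOpen_lt ((α.strong_cont' b).comp (continuous_mul_const s)).norm
        continuous_const).mem_nhds (by simpa using hN)
    refine le_of_tendsto (P.tendsto_check_tensor μ h hz s b x).norm ?_
    filter_upwards [h.eventually_subset (inter_mem (h.mem_nhds V V.2) hW)] with U hU
    have h1 := norm_check_tensor_le μ (α := α) (ω := ω) (hz.nonneg (OrderDual.ofDual U))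
      (hz.integral_modulus μ _) s b (w := w * c) (N := N)
      (fun r hr => (hc r).trans
        (mul_le_mul_of_nonneg_right (le_ciSup hb ⟨r, (hU (hz.supp _ hr)).1⟩) hc0))
      (fun r hr => (show ‖α (r * s) b‖ < N from (hU (hz.supp _ hr)).2).le)
    have h2 : ‖P.integrated μ (toL1 μ α ω
        (check α (tensor (transR (z (OrderDual.ofDual U)) s) b)))‖ ≤
        ‖P.integrated μ‖ * (w * c * N) :=
      (P.integrated μ).le_of_opNorm_le_of_le le_rfl
        (by rw [toL1, UniformSpace.Completion.norm_coe]; exact h1)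
    exact (ContinuousLinearMap.le_of_opNorm_le _ h2 x).trans_eq (by ring)
  have hcont : Continuous fun N : ℝ => w * (‖P.integrated μ‖ * c * N * ‖x‖) := by fun_prop
  exact ge_of_tendsto ((hcont.tendsto _).mono_left nhdsWithin_le_nhds)
    (by filter_upwards [self_mem_nhdsWithin] with N hN using key N hN : ∀ᶠ N in 𝓝[>] ‖α s b‖, _)

theorem norm_π_le (P : AAPair α ω X) {𝒵 : Set (Set G)} (h : IsCompactNhdBase 𝒵) :
    ‖P.π‖ ≤ (⨅ V : 𝒵, ⨆ r : V.1, ω r) * ‖P.integrated μ‖ := by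
  have hκ := iInf_iSup_weight_nonneg ω 𝒵
  refine ContinuousLinearMap.opNorm_le_bound₂ _ (by positivity) fun a x => ?_
  have h1 := P.norm_π_U_le μ h 1 zero_le_one (by simp) a x
  rw [P.U_one, map_one] at h1
  exact h1.trans_eq (by simp only [one_apply_eq_self]; ring)

theorem norm_U_le (P : AAPair α ω X) {𝒵 : Set (Set G)} (h : IsCompactNhdBase 𝒵) {I : Type*}
    [Preorder I] [IsDirected I (· ≤ ·)] [Nonempty I] {u : I → A} (hu : IsBddApproxRightId u)
    {M : ℝ} (hM : ∀ i, ‖u i‖ ≤ M) (s : G) :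
    ‖P.U s‖ ≤ M * (⨅ V : 𝒵, ⨆ r : V.1, ω r) * ‖P.integrated μ‖ * ω s := by
  have hκ := iInf_iSup_weight_nonneg ω 𝒵
  have hω := ω.nonneg' s
  have hM0 : 0 ≤ M := (norm_nonneg _).trans (hM (Classical.arbitrary I))
  refine ContinuousLinearMap.opNorm_le_bound _ (by positivity) fun x => ?_
  refine le_of_tendsto (((P.U s).continuous.tendsto _).comp (P.tendsto_π_approx hu x)).norm
    (Eventually.of_forall fun i => ?_)
  -- With `b = α_{s⁻¹}(u_i)` one has `π(b) U_s x = U_s π(u_i) x` and `α_s(b) = u_i`, so the bound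
  -- involves `M` and not `sup ‖α_s‖`.
  have h1 := P.norm_π_U_le μ h s hω (fun r => ω.submul' r s) (α s⁻¹ (u i)) x
  rw [← P.U_π, α.apply_inv_apply] at h1
  refine h1.trans ?_
  calc _ ≤ (⨅ V : 𝒵, ⨆ r : V.1, ω r) * (‖P.integrated μ‖ * ω s * M * ‖x‖) := by
        gcongr
        exact hM i
    _ = _ := by ring

end AAPair

end Bounds

end BeurlingAnti

/-! ### The main theorem. -/

open BeurlingAnti in
theorem mainTheorem6 {𝕜 G A X : Type*} [RCLike 𝕜]
    [Group G] [TopologicalSpace G] [IsTopologicalGroup G] [LocallyCompactSpace G] [T2Space G]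
    [MeasurableSpace G] [BorelSpace G] (μ : Measure G) [μ.IsHaarMeasure] [μ.Regular]
    [NonUnitalNormedRing A] [NormedSpace 𝕜 A] [IsScalarTower 𝕜 A A] [SMulCommClass 𝕜 A A]
    [CompleteSpace A] [NormedSpace ℝ A] [IsScalarTower ℝ 𝕜 A]
    [NormedAddCommGroup X] [NormedSpace 𝕜 X] [CompleteSpace X]
    [NormedSpace ℝ X] [IsScalarTower ℝ 𝕜 X]
    (α : BddDynSystem 𝕜 G A) (ω : Weight G)
    {J : Type*} [Preorder J] [IsDirected J (· ≤ ·)] [Nonempty J]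
    (v : J → A) (hv : IsBddApproxId v) :
    ∃ e : AAPair α ω X ≃ AntiRep μ α ω X,
      (∀ (P : AAPair α ω X) (f : C_c(G, A)) (x : X),
        (e P).T (toL1 μ α ω f) x = ∫ r, P.U r (P.π (f r) x) ∂μ) ∧
      (∀ (T : AntiRep μ α ω X) (𝒵 : Set (Set G)) (_ : IsCompactNhdBase 𝒵)
        (z : 𝒵 → C_c(G, ℝ)) (_ : IsBumpFamily μ 𝒵 z)
        (I : Type*) [Preorder I] [IsDirected I (· ≤ ·)] [Nonempty I]
        (u : I → A) (_ : IsBddApproxRightId u),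
        (∀ (a : A) (x : X), Tendsto
          (fun p : (↥𝒵)ᵒᵈ × I =>
            T.T (toL1 μ α ω (check α (tensor (z (OrderDual.ofDual p.1)) (u p.2 * a)))) x)
          atTop (𝓝 ((e.symm T).π a x))) ∧
        (∀ (s : G) (x : X), Tendsto
          (fun p : (↥𝒵)ᵒᵈ × I =>
            T.T (toL1 μ α ω (check α (tensor (transR (z (OrderDual.ofDual p.1)) s) (u p.2)))) x)
          atTop (𝓝 ((e.symm T).U s x)))) ∧
      (∀ (P : AAPair α ω X) (C : ℝ), (∀ r, ‖P.U r‖ ≤ C * ω r) → ‖(e P).T‖ ≤ C * ‖P.π‖) ∧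
      (∀ (T : AntiRep μ α ω X) (𝒵 : Set (Set G)), IsCompactNhdBase 𝒵 →
        ‖(e.symm T).π‖ ≤ (⨅ V : 𝒵, ⨆ r : V.1, ω r) * ‖T.T‖) ∧
      (∀ (T : AntiRep μ α ω X) (𝒵 : Set (Set G)), IsCompactNhdBase 𝒵 →
        ∀ (I : Type*) [Preorder I] [IsDirected I (· ≤ ·)] [Nonempty I]
          (u : I → A), IsBddApproxRightId u →
          ∀ M : ℝ, (∀ i, ‖u i‖ ≤ M) → ∀ s : G,
            ‖(e.symm T).U s‖ ≤ M * (⨅ V : 𝒵, ⨆ r : V.1, ω r) * ‖T.T‖ * ω s) := by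
  have hv' := hv.toIsBddApproxRightId
  let e : AAPair α ω X ≃ AntiRep μ α ω X := Equiv.ofBijective (AAPair.toAntiRep μ)
    ⟨AAPair.toAntiRep_injective μ hv', fun T => T.exists_pair μ hv'⟩
  refine ⟨e, fun P f x => P.integrated_toL1_apply μ f x, ?_, fun P C hC =>
    P.norm_integrated_le μ hC, ?_, ?_⟩
  · intro T 𝒵 h𝒵 z hz I _ _ _ u hu
    -- Surjectivity reduces statements about the recovered pair to statements about a given pair `P`
    -- and its integrated form.
    obtain ⟨P, rfl⟩ := e.surjective T
    rw [e.symm_apply_apply]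
    obtain ⟨M, hM⟩ := hu.bdd
    refine ⟨fun a x => ?_, fun s x =>
      P.tendsto_joint μ h𝒵 hz hM s (P.tendsto_π_approx hu (P.U s x))⟩
    -- The formula for `π` is the joint limit at `s = e` with `b_i = u_i a`, since `π(u_i a) = π(a)
    -- π(u_i)`.
    have hlim : Tendsto (fun i => P.π (u i * a) (P.U 1 x)) atTop (𝓝 (P.π a x)) := by
      simp only [P.π_mul_apply, P.U_one]
      exact ((P.π a).continuous.tendsto x).comp (P.tendsto_π_approx hu x)
    have hM' : ∀ i, ‖u i * a‖ ≤ M * ‖a‖ := fun i =>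
      (norm_mul_le _ _).trans (mul_le_mul_of_nonneg_right (hM i) (norm_nonneg a))
    have := P.tendsto_joint μ h𝒵 hz hM' 1 hlim
    simp only [transR_one] at this
    exact this
  · intro T 𝒵 h𝒵
    obtain ⟨P, rfl⟩ := e.surjective T
    rw [e.symm_apply_apply]
    exact P.norm_π_le μ h𝒵
  · intro T 𝒵 h𝒵 I _ _ _ u hu M hM s
    obtain ⟨P, rfl⟩ := e.surjective T
    rw [e.symm_apply_apply]
    exact P.norm_U_le μ h𝒵 hu hM s
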